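/- Let $T>0$, $n\ge 1$, let $S^1_T$ be the circle of circumference $T$, and consider $\dot x=f(t,x)$, where $f\in C^0(S^1_T\times\mathbb R^n,\mathbb R^n)$ (so $f$ is $T$-periodic in $t$) and all first order partial derivatives of $f$ with respect to $x$ exist and are continuous functions of $(t,x)$. Assume that every solution exists for all forward times. For $\theta\ge 0$ let $S^x_\theta(t_0,x_0)$ be the value at time $t_0+\theta$ of the solution with $x(t_0)=x_0$, and let $S_\theta(t_0,x_0)=(t_0+\theta \bmod T,\,S^x_\theta(t_0,x_0))$ be the flow on the cylinder $S^1_T\times\mathbb R^n$. Let $M$ be a Riemannian metric in the weak sense, i.e. a continuous map from $S^1_T\times\mathbb R^n$ to the symmetric $n\times n$ matrices such that $M(t,x)$ is positive definite for all $(t,x)$; $M$ is locally Lipschitz in $x$, i.e. every point has a neighbourhood $U$ and a constant $L$ with $\|M(t,x)-M(t,y)\|\le L\|x-y\|$ for all $(t,x),(t,y)\in U$; and the forward orbital derivative $$M'_+(t,x)=\lim_{\theta\to0^+}\frac{M(S_\theta(t,x))-M(t,x)}{\theta}$$ exists for all $(t,x)\in S^1_T\times\mathbb R^n$. Put $$L_M(t,x)=\sup_{w\in\mathbb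 R^n,\ w^TM(t,x)w=1} w^T\Big[M(t,x)D_xf(t,x)+\tfrac12 M'_+(t,x)\Big]w .$$ Let $\varnothing\ne G\subset S^1_T\times\mathbb R^n$ be compact, connected and positively invariant ($S_\theta G\subset G$ for all $\theta\ge0$), let $\nu>0$, and assume $L_M(t,x)\le-\nu$ for all $(t,x)\in G$. Then $G$ contains exactly one periodic orbit $\Omega$ of the flow $S_\theta$, that is, exactly one set $\Omega=\{S_\theta z:\theta\ge0\}$ with $S_\tau z=z$ for some $\tau>0$. It is exponentially asymptotically stable: there are $\delta,C,\mu>0$ such that $\|S^x_\theta(t,x)-S^x_\theta(t,x_0)\|\le Ce^{-\mu\theta}\|x-x_0\|$ for all $\theta\ge0$, all $(t,x_0)\in\Omega$ and all $x$ with $\|x-x_0\|\le\delta$. Moreover $G\subset A(\Omega)$, where $A(\Omega)=\{z:\operatorname{dist}(S_\theta z,\Omega)\to0\text{ as }\theta\to\infty\}$ is the basin of attraction. If, in addition, $\int_0^T p(t)^TM'_+(t,x(t))p(t)\,dt$ exists and is finite for all solutions $x(t)$ with $(0,x(0))\in G$ and all $p\in C^0([0,T],\mathbb R^n)$, then the largest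 real part $-\nu_0$ of all Floquet exponents of $\Omega$ exists and satisfies $-\nu_0\le-\nu$. Here, with $\tau$ the minimal period of $\Omega$, a Floquet exponent is a number $\lambda\in\mathbb C$ for which the first variation equation $\dot y=D_xf(S_\theta z)\,y$ along $\Omega$ ($z\in\Omega$) has a nontrivial solution $y(\theta)=e^{\lambda\theta}p(\theta)$ with a $\tau$-periodic function $p$ with values in $\mathbb C^n$. -/

import Mathlib

open Set Filter Topology MeasureTheory Matrix

noncomputable section

namespace PeriodicContraction

/-- The state space `ℝⁿ` with the Euclidean norm. -/
abbrev State (n : ℕ) : Type := EuclideanSpace ℝ (Fin n)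

/-- The cylinder `S¹_T × ℝⁿ`; `AddCircle T = ℝ / Tℤ` is the circle of circumference `T`.
A function on the cylinder is the same thing as a function of `(t, x)` that is `T`-periodic
in `t`. -/
abbrev Cylinder (T : ℝ) (n : ℕ) : Type := AddCircle T × State n

variable {T : ℝ} {n : ℕ}

/-- `partialX f j (t, x) = ∂f/∂x_j (t, x)`, a vector of `ℝⁿ`. -/
def partialX (f : Cylinder T n → State n) (j : Fin n) (z : Cylinder T n) : State n :=
  lineDeriv ℝ (fun x : State n => f (z.1, x)) z.2 (EuclideanSpace.single j (1 : ℝ))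

/-- The Jacobian matrix `D_x f (t, x) = (∂f_i/∂x_j (t, x))_{ij}`. -/
def jacobianX (f : Cylinder T n → State n) (z : Cylinder T n) : Matrix (Fin n) (Fin n) ℝ :=
  Matrix.of fun i j => partialX f j z i

/-- `f` is continuous, and all its first order partial derivatives with respect to `x` exist and
are continuous functions of `(t, x)`. -/
structure IsAdmissible (f : Cylinder T n → State n) : Prop where
  continuous : Continuous f
  differentiable : ∀ (z : Cylinder T n) (j : Fin n),
    LineDifferentiableAt ℝ (fun x : State n => f (z.1, x)) z.2 (EuclideanSpace.single j (1 : ℝ))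
  continuous_partial : ∀ j : Fin n, Continuous (partialX f j)

/-- `y` solves `ẋ = f(t, x)` with initial value `x₀` at time `t₀`, where `z = (t₀, x₀)`, for all
later times; the argument `θ ≥ 0` of `y` is the time elapsed since `t₀`. -/
def IsForwardSolution (f : Cylinder T n → State n) (z : Cylinder T n) (y : ℝ → State n) : Prop :=
  y 0 = z.2 ∧
    ∀ θ : ℝ, 0 ≤ θ → HasDerivWithinAt y (f (z.1 + (θ : AddCircle T), y θ)) (Ici 0) θ

/-- Every initial value problem has a solution for all forward times. -/
def ForwardComplete (f : Cylinder T n → State n) : Prop :=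
  ∀ z : Cylinder T n, ∃ y : ℝ → State n, IsForwardSolution f z y

open Classical in
/-- `flowX f θ (t₀, x₀)` is the value, after the elapsed time `θ ≥ 0`, of the solution through
`(t₀, x₀)`. Meaningful when that solution exists for all forward times (it is then unique for an
admissible `f`) and `θ ≥ 0`. -/
def flowX (f : Cylinder T n → State n) (θ : ℝ) (z : Cylinder T n) : State n :=
  if h : ∃ y : ℝ → State n, IsForwardSolution f z y then h.choose θ else z.2

/-- The flow `S_θ (t₀, x₀) = (t₀ + θ mod T, x(t₀ + θ))` on the cylinder, for `θ ≥ 0`. -/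
def flow (f : Cylinder T n → State n) (θ : ℝ) (z : Cylinder T n) : Cylinder T n :=
  (z.1 + (θ : AddCircle T), flowX f θ z)

/-- Positive invariance. -/
def PositivelyInvariant (f : Cylinder T n → State n) (G : Set (Cylinder T n)) : Prop :=
  ∀ z ∈ G, ∀ θ : ℝ, 0 ≤ θ → flow f θ z ∈ G

/-- The difference quotient `(M(S_θ z) - M(z)) / θ`. -/
def orbitalQuotient (f : Cylinder T n → State n) (M : Cylinder T n → Matrix (Fin n) (Fin n) ℝ)
    (z : Cylinder T n) (θ : ℝ) : Matrix (Fin n) (Fin n) ℝ :=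
  θ⁻¹ • (M (flow f θ z) - M z)

/-- The forward orbital derivative `M'₊(z) = lim_{θ → 0⁺} (M(S_θ z) - M(z)) / θ`. -/
def forwardOrbitalDeriv (f : Cylinder T n → State n)
    (M : Cylinder T n → Matrix (Fin n) (Fin n) ℝ) (z : Cylinder T n) :
    Matrix (Fin n) (Fin n) ℝ :=
  limUnder (𝓝[>] (0 : ℝ)) (orbitalQuotient f M z)

/-- A Riemannian metric for `ẋ = f(t, x)` in the weak sense: continuous, symmetric and positive
definite, locally Lipschitz in `x` (in the maximum norm of matrices), and with a forward orbital
derivative at every point. -/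
structure IsRiemannianMetric (f : Cylinder T n → State n)
    (M : Cylinder T n → Matrix (Fin n) (Fin n) ℝ) : Prop where
  continuous : Continuous M
  posDef : ∀ z : Cylinder T n, (M z).PosDef
  locallyLipschitz : ∀ z₀ : Cylinder T n, ∃ U ∈ 𝓝 z₀, ∃ L : ℝ,
    ∀ (t : AddCircle T) (x y : State n), (t, x) ∈ U → (t, y) ∈ U →
      ∀ i j : Fin n, |M (t, x) i j - M (t, y) i j| ≤ L * ‖x - y‖
  orbitalDeriv_exists : ∀ z : Cylinder T n, ∃ M' : Matrix (Fin n) (Fin n) ℝ,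
    Tendsto (orbitalQuotient f M z) (𝓝[>] (0 : ℝ)) (𝓝 M')

/-- `L_M(z) = sup { wᵀ [M(z) D_x f(z) + ½ M'₊(z)] w : w ∈ ℝⁿ, wᵀ M(z) w = 1 }`, with the
supremum taken in the extended reals. -/
def contractionFun (f : Cylinder T n → State n) (M : Cylinder T n → Matrix (Fin n) (Fin n) ℝ)
    (z : Cylinder T n) : EReal :=
  ⨆ (w : Fin n → ℝ) (_ : w ⬝ᵥ (M z *ᵥ w) = 1),
    ((w ⬝ᵥ ((M z * jacobianX f z + (1 / 2 : ℝ) • forwardOrbitalDeriv f M z) *ᵥ w) : ℝ) : EReal)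

/-- `Ω` is a periodic orbit of the flow on the cylinder: the orbit of a point `z` with
`S_τ z = z` for some `τ > 0` (which then is a multiple of the circumference `T`). -/
def IsPeriodicOrbit (f : Cylinder T n → State n) (Ω : Set (Cylinder T n)) : Prop :=
  ∃ (z : Cylinder T n) (τ : ℝ), 0 < τ ∧ flow f τ z = z ∧ Ω = (fun θ : ℝ => flow f θ z) '' Ici 0

/-- `Ω` is exponentially asymptotically stable: solutions that start, at the same initial time,
sufficiently close to a point of `Ω` approach the solution through that point exponentially fast,
uniformly along `Ω`. As time is a coordinate of the cylinder, no phase shift occurs. -/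
def IsExponentiallyStable (f : Cylinder T n → State n) (Ω : Set (Cylinder T n)) : Prop :=
  ∃ δ > (0 : ℝ), ∃ C > (0 : ℝ), ∃ μ > (0 : ℝ), ∀ (t : AddCircle T) (x₀ x : State n),
    (t, x₀) ∈ Ω → ‖x - x₀‖ ≤ δ → ∀ θ : ℝ, 0 ≤ θ →
      ‖flowX f θ (t, x) - flowX f θ (t, x₀)‖ ≤ C * Real.exp (-μ * θ) * ‖x - x₀‖

/-- The basin of attraction `A(Ω) = { z : dist (S_θ z, Ω) → 0 as θ → ∞ }`. -/
def basin (f : Cylinder T n → State n) (Ω : Set (Cylinder T n)) : Set (Cylinder T n) :=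
  {z | Tendsto (fun θ : ℝ => Metric.infDist (flow f θ z) Ω) atTop (𝓝 0)}

/-- `y : [0, ∞) → ℂⁿ` solves the first variation equation `ẏ = D_x f(S_θ z) y` along the
trajectory of `z`. -/
def IsVariationSolution (f : Cylinder T n → State n) (z : Cylinder T n)
    (y : ℝ → Fin n → ℂ) : Prop :=
  ∀ θ : ℝ, 0 ≤ θ →
    HasDerivWithinAt y ((jacobianX f (flow f θ z)).map Complex.ofReal *ᵥ y θ) (Ici 0) θ

/-- `l` is a Floquet exponent of the periodic orbit `Ω`: for a point `z` of `Ω` with minimal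
period `τ`, the first variation equation along `Ω` has a nontrivial solution of the form
`y(θ) = exp (l θ) p(θ)` with a `τ`-periodic function `p`. -/
def IsFloquetExponent (f : Cylinder T n → State n) (Ω : Set (Cylinder T n)) (l : ℂ) : Prop :=
  ∃ z ∈ Ω, ∃ τ : ℝ, IsLeast {s : ℝ | 0 < s ∧ flow f s z = z} τ ∧
    ∃ p : ℝ → Fin n → ℂ, p 0 ≠ 0 ∧ (∀ θ : ℝ, 0 ≤ θ → p (θ + τ) = p θ) ∧
      IsVariationSolution f z fun θ => Complex.exp (l * θ) • p θ

/-- The integral `∫₀ᵀ p(t)ᵀ M'₊(t, x(t)) p(t) dt` exists and is finite for every solution `x`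
with `(0, x(0)) ∈ G` and every continuous `p : [0, T] → ℝⁿ`. -/
def OrbitalDerivIntegrable (f : Cylinder T n → State n)
    (M : Cylinder T n → Matrix (Fin n) (Fin n) ℝ) (G : Set (Cylinder T n)) : Prop :=
  ∀ x₀ : State n, ((0 : AddCircle T), x₀) ∈ G →
    ∀ p : ℝ → Fin n → ℝ, ContinuousOn p (Icc 0 T) →
      IntegrableOn
        (fun t : ℝ => p t ⬝ᵥ (forwardOrbitalDeriv f M (flow f t ((0 : AddCircle T), x₀)) *ᵥ p t))
        (Icc 0 T) volume

end PeriodicContraction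

end

/-! ### First order expansion of the vector field, uniqueness of solutions, semigroup law. -/

namespace PeriodicContraction

variable {T : ℝ} {n : ℕ} {f : Cylinder T n → State n}

/-! Let `v` be the difference of two solutions with the same initial time, one of them in `G`, and
measure it by the quadratic form `Q = vᵀ M v`, with `M` taken along the trajectory in `G`. Its right
derivative is `2 vᵀ M Δf + vᵀ M'₊ v`. Since `G` is compact, `Δf = D_x f v + o(‖v‖)` uniformly, so
`L_M ≤ -ν` gives `Q' ≤ -ν Q` as long as `v` is small; Gronwall and the comparison of `Q` with the
Euclidean norm then keep `v` small. This is `exists_exp_contraction`, and everything about `Ω`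
except the Floquet bound follows from it.

Existence: by compactness some trajectory returns to its own fibre within the contraction radius
after a multiple `N` of `T`. Contraction makes the iterates of `S_N` Cauchy, and their limit is a
fixed point of `S_N` (`exists_flow_eq_self`). Basin: two nearby points of `G` can be brought into
one fibre by a short flow, so they lie in the basin together; connectedness spreads the basin over
all of `G` (`subset_basin`). Uniqueness: a periodic point in the basin stays at constant distance
from the orbit at its return times, so that distance is zero.

For the linear first variation equation the form estimate has no error term and keeps the full rate
`ν`. The multipliers, i.e. the eigenvalues of the period map on `ℂⁿ`, therefore have modulus at most
`exp (-ν τ)`, and real parts of Floquet exponents are `log |κ| / τ` (`isGreatest_floquet`). -/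

theorem norm_le_of_abs_le {u v : State n} (h : ∀ i, |u i| ≤ |v i|) : ‖u‖ ≤ ‖v‖ := by
  rw [EuclideanSpace.norm_eq, EuclideanSpace.norm_eq]
  apply Real.sqrt_le_sqrt
  gcongr with i
  simpa using h i

theorem abs_apply_le_norm (v : State n) (i : Fin n) : |v i| ≤ ‖v‖ := by
  simpa using PiLp.norm_apply_le v i

/-- The derivative of `f` in the direction `v` of the state space. -/
noncomputable def dirDeriv (f : Cylinder T n → State n) (z : Cylinder T n) (v : State n) :
    State n :=
  ∑ j, v j • partialX f j z

theorem dirDeriv_apply (z : Cylinder T n) (v : State n) (i : Fin n) :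
    dirDeriv f z v i = (jacobianX f z *ᵥ v.ofLp) i := by
  simp [dirDeriv, jacobianX, Matrix.mulVec, dotProduct, mul_comm]

theorem norm_dirDeriv_le {P : ℝ} {z : Cylinder T n} (hP : ∀ j, ‖partialX f j z‖ ≤ P)
    (v : State n) : ‖dirDeriv f z v‖ ≤ n * P * ‖v‖ := by
  calc ‖dirDeriv f z v‖ ≤ ∑ j, ‖v j • partialX f j z‖ := norm_sum_le _ _
    _ ≤ ∑ _j : Fin n, ‖v‖ * P := by
        gcongr with j
        rw [norm_smul]
        gcongr
        · exact PiLp.norm_apply_le v j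
        · exact hP j
    _ = n * P * ‖v‖ := by simp; ring

/-- Only partial derivatives are given, so the coordinates in `s` are moved one at a time, with the
mean value inequality on each segment. Every intermediate point has increments bounded
coordinatewise by `v`, hence stays in the `δ`-ball where the partials vary by at most `ε`. -/
theorem norm_increment_sub_le (hf : IsAdmissible f) {ε δ : ℝ} {z : Cylinder T n} {v : State n}
    (hv : ‖v‖ ≤ δ)
    (h : ∀ j, ∀ y : State n, ‖y - z.2‖ ≤ δ → ‖partialX f j (z.1, y) - partialX f j z‖ ≤ ε)
    (s : Finset (Fin n)) :
    ‖f (z.1, z.2 + ∑ j ∈ s, EuclideanSpace.single j (v j)) - f z - ∑ j ∈ s, v j • partialX f j z‖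
      ≤ ∑ j ∈ s, ε * |v j| := by
  induction s using Finset.induction_on with
  | empty => simp
  | insert j s hj ih =>
    rw [Finset.sum_insert hj, Finset.sum_insert hj, Finset.sum_insert hj]
    set w := z.2 + ∑ j ∈ s, EuclideanSpace.single j (v j) with hw
    have key : ‖(f (z.1, w + (1 : ℝ) • EuclideanSpace.single j (v j)) -
        (1 : ℝ) • v j • partialX f j z) -
        (f (z.1, w + (0 : ℝ) • EuclideanSpace.single j (v j)) -
        (0 : ℝ) • v j • partialX f j z)‖ ≤ ε * |v j| := by
      apply norm_image_sub_le_of_norm_deriv_le_segment_01'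
        (f := fun r : ℝ => f (z.1, w + r • EuclideanSpace.single j (v j)) -
          r • v j • partialX f j z)
        (f' := fun r : ℝ => v j • partialX f j (z.1, w + r • EuclideanSpace.single j (v j)) -
          v j • partialX f j z)
      · intro r _
        apply HasDerivAt.hasDerivWithinAt
        apply HasDerivAt.sub
        · have h1 := (hf.differentiable (z.1, w + r • EuclideanSpace.single j (v j)) j).hasLineDerivAt
          unfold HasLineDerivAt at h1
          have h2 : HasDerivAt (fun s : ℝ => (s - r) * v j) (v j) r := by
            simpa using ((hasDerivAt_id r).sub_const r).mul_const (v j)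
          have h1' : HasDerivAt (fun t : ℝ => f (z.1, w + r • EuclideanSpace.single j (v j) +
              t • EuclideanSpace.single j (1 : ℝ))) 
              (partialX f j (z.1, w + r • EuclideanSpace.single j (v j))) ((r - r) * v j) := by
            rw [sub_self, zero_mul]
            exact h1
          have h3 := HasDerivAt.scomp r h1' h2
          refine h3.congr_of_eventuallyEq (Eventually.of_forall fun s => ?_)
          simp only [Function.comp]
          congr 2
          ext i
          by_cases hi : i = j
          · subst hi; simp; ring
          · simp [hi]
        · simpa using (hasDerivAt_id r).smul_const (v j • partialX f j z)
      · intro r hr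
        rw [← smul_sub, norm_smul, Real.norm_eq_abs, mul_comm]
        gcongr
        apply h
        refine le_trans (norm_le_of_abs_le fun i => ?_) hv
        have hsum : (∑ j ∈ s, EuclideanSpace.single j (v j) : State n) i =
            if i ∈ s then v i else 0 := by
          rw [WithLp.ofLp_sum, Finset.sum_apply]
          simp
        simp only [hw, add_sub_cancel_left, add_assoc, PiLp.add_apply, hsum]
        by_cases hi : i = j
        · subst hi
          simp [hj, abs_mul, abs_of_nonneg hr.1]
          exact mul_le_of_le_one_left (abs_nonneg _) hr.2.le
        · by_cases his : i ∈ s <;> simp [hi, his]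
    have e : f (z.1, z.2 + (EuclideanSpace.single j (v j) +
          ∑ j ∈ s, EuclideanSpace.single j (v j))) - f z -
        (v j • partialX f j z + ∑ j ∈ s, v j • partialX f j z) =
        ((f (z.1, w + (1 : ℝ) • EuclideanSpace.single j (v j)) -
        (1 : ℝ) • v j • partialX f j z) -
        (f (z.1, w + (0 : ℝ) • EuclideanSpace.single j (v j)) -
        (0 : ℝ) • v j • partialX f j z)) + (f (z.1, w) - f z - ∑ j ∈ s, v j • partialX f j z) := by
      simp only [one_smul, zero_smul, add_zero, sub_zero]
      rw [show z.2 + (EuclideanSpace.single j (v j) + ∑ j ∈ s, EuclideanSpace.single j (v j)) =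
        w + EuclideanSpace.single j (v j) by rw [hw]; abel]
      abel
    rw [e]
    exact (norm_add_le _ _).trans (add_le_add key ih)

/-- Differentiability in `x` with a remainder uniform over `K`, from the uniform continuity of the
partials at points of `K`. -/
theorem exists_norm_increment_sub_le (hf : IsAdmissible f) {K : Set (Cylinder T n)}
    (hK : IsCompact K) {ε : ℝ} (hε : 0 < ε) :
    ∃ δ > 0, ∀ z ∈ K, ∀ v : State n, ‖v‖ ≤ δ →
      ‖f (z.1, z.2 + v) - f z - dirDeriv f z v‖ ≤ ε * ‖v‖ := by
  set η := ε / (n + 1) with hη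
  have hη0 : 0 < η := by positivity
  have h1 : ∀ j : Fin n, ∃ δ > 0, ∀ z ∈ K, ∀ y, dist z y < δ →
      dist (partialX f j z) (partialX f j y) < η := by
    intro j
    -- Only the base point has to lie in `K`; the comparison point is arbitrary. This matters
    -- because the neighbouring solutions need not stay in `G`.
    have := hK.uniformContinuousAt_of_continuousAt (partialX f j)
      (fun a _ => (hf.continuous_partial j).continuousAt) (Metric.dist_mem_uniformity hη0)
    obtain ⟨δ, hδ, h⟩ := Metric.mem_uniformity_dist.1 this
    exact ⟨δ, hδ, fun z hz y hy => h hy hz⟩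
  choose d hd0 hd using h1
  obtain ⟨δ, hδ0, hδ⟩ : ∃ δ > 0, ∀ j, δ < d j := by
    have : ∀ᶠ δ in 𝓝[>] (0 : ℝ), ∀ j, δ < d j :=
      eventually_all.2 fun j => eventually_nhdsWithin_of_eventually_nhds (eventually_lt_nhds (hd0 j))
    obtain ⟨δ, h1, h2⟩ := (this.and self_mem_nhdsWithin).exists
    exact ⟨δ, h2, h1⟩
  refine ⟨δ, hδ0, fun z hz v hv => ?_⟩
  have := norm_increment_sub_le hf (ε := η) (z := z) hv (fun j y hy => ?_) Finset.univ
  · have hs : (∑ j, EuclideanSpace.single j (v j) : State n) = v := by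
      ext i
      rw [WithLp.ofLp_sum, Finset.sum_apply]
      simp
    rw [hs] at this
    refine this.trans ?_
    calc ∑ j, η * |v j| ≤ ∑ _j : Fin n, η * ‖v‖ := by
          gcongr with j
          exact abs_apply_le_norm v j
      _ = n * η * ‖v‖ := by simp; ring
      _ ≤ ε * ‖v‖ := by
          gcongr
          rw [hη, mul_div_assoc', div_le_iff₀ (by positivity)]
          nlinarith
  · rw [← dist_eq_norm, dist_comm]
    refine (hd j z hz _ ?_).le
    refine lt_of_le_of_lt ?_ (hδ j)
    rw [Prod.dist_eq]
    simpa [dist_comm, dist_eq_norm, hδ0.le, norm_sub_rev] using hy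

/-- Pairs closer than `δ` are handled by the uniform expansion, the others by boundedness of `f`,
which costs the constant `2 * F / δ`. The circle is compact, so one constant serves all times. -/
theorem exists_lipschitzOnWith_closedBall (hT : 0 < T) (hf : IsAdmissible f) (R : ℝ) :
    ∃ L : NNReal, ∀ t : AddCircle T,
      LipschitzOnWith L (fun x => f (t, x)) (Metric.closedBall 0 R) := by
  have : Fact (0 < T) := ⟨hT⟩
  have hK : IsCompact ((univ : Set (AddCircle T)) ×ˢ Metric.closedBall (0 : State n) R) :=
    isCompact_univ.prod (isCompact_closedBall 0 R)
  obtain ⟨δ, hδ0, hδ⟩ := exists_norm_increment_sub_le hf hK one_pos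
  obtain ⟨F, hF⟩ := hK.exists_bound_of_continuousOn hf.continuous.continuousOn
  have hP : ∀ j, ∃ P, ∀ z ∈ ((univ : Set (AddCircle T)) ×ˢ Metric.closedBall (0 : State n) R),
      ‖partialX f j z‖ ≤ P := fun j =>
    hK.exists_bound_of_continuousOn (hf.continuous_partial j).continuousOn
  choose P hP using hP
  have hP' : ∀ z ∈ ((univ : Set (AddCircle T)) ×ˢ Metric.closedBall (0 : State n) R), ∀ j,
      ‖partialX f j z‖ ≤ ∑ i, |P i| := fun z hz j =>
    ((hP j z hz).trans (le_abs_self _)).trans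
      (Finset.single_le_sum (f := fun i => |P i|) (fun i _ => abs_nonneg _) (Finset.mem_univ j))
  set Q := ∑ i, |P i|
  have hQ : 0 ≤ Q := Finset.sum_nonneg fun i _ => abs_nonneg _
  refine ⟨(max (1 + n * Q) (2 * F / δ)).toNNReal, fun t => ?_⟩
  apply LipschitzOnWith.of_dist_le_mul
  intro x hx y hy
  have hL : 0 ≤ max (1 + n * Q) (2 * F / δ) := le_max_of_le_left (by positivity)
  rw [Real.coe_toNNReal _ hL, dist_eq_norm, dist_eq_norm]
  have hx' : (t, x) ∈ (univ : Set (AddCircle T)) ×ˢ Metric.closedBall (0 : State n) R :=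
    ⟨mem_univ _, hx⟩
  have hy' : (t, y) ∈ (univ : Set (AddCircle T)) ×ˢ Metric.closedBall (0 : State n) R :=
    ⟨mem_univ _, hy⟩
  rcases le_or_gt ‖x - y‖ δ with h | h
  · have h1 := hδ _ hy' (x - y) h
    simp only [add_sub_cancel] at h1
    have h2 := norm_dirDeriv_le (hP' _ hy') (x - y)
    have h3 : ‖f (t, x) - f (t, y)‖ ≤
        ‖f (t, x) - f (t, y) - dirDeriv f (t, y) (x - y)‖ + ‖dirDeriv f (t, y) (x - y)‖ := by
      simpa using norm_add_le (f (t, x) - f (t, y) - dirDeriv f (t, y) (x - y))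
        (dirDeriv f (t, y) (x - y))
    calc ‖f (t, x) - f (t, y)‖ ≤ (1 + n * Q) * ‖x - y‖ := by linarith
      _ ≤ _ := by gcongr; exact le_max_left _ _
  · have h3 : ‖f (t, x) - f (t, y)‖ ≤ 2 * F := by
      have := norm_sub_le (f (t, x)) (f (t, y))
      linarith [hF _ hx', hF _ hy']
    have hF0 : 0 ≤ F := (norm_nonneg _).trans (hF _ hx')
    calc ‖f (t, x) - f (t, y)‖ ≤ 2 * F := h3
      _ = 2 * F / δ * δ := by field_simp
      _ ≤ max (1 + n * Q) (2 * F / δ) * ‖x - y‖ := by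
        gcongr
        exact le_max_right _ _

theorem IsForwardSolution.continuousOn {z : Cylinder T n} {y : ℝ → State n}
    (h : IsForwardSolution f z y) : ContinuousOn y (Ici 0) :=
  fun θ hθ => (h.2 θ hθ).continuousWithinAt

theorem IsForwardSolution.eq (hT : 0 < T) (hf : IsAdmissible f) {z : Cylinder T n}
    {y₁ y₂ : ℝ → State n} (h₁ : IsForwardSolution f z y₁) (h₂ : IsForwardSolution f z y₂)
    {θ : ℝ} (hθ : 0 ≤ θ) : y₁ θ = y₂ θ := by
  have c₁ : ContinuousOn y₁ (Icc 0 θ) := h₁.continuousOn.mono Icc_subset_Ici_self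
  have c₂ : ContinuousOn y₂ (Icc 0 θ) := h₂.continuousOn.mono Icc_subset_Ici_self
  obtain ⟨R₁, hR₁⟩ := isCompact_Icc.exists_bound_of_continuousOn c₁
  obtain ⟨R₂, hR₂⟩ := isCompact_Icc.exists_bound_of_continuousOn c₂
  obtain ⟨L, hL⟩ := exists_lipschitzOnWith_closedBall hT hf (max R₁ R₂)
  refine ODE_solution_unique_of_mem_Icc_right (K := L)
    (v := fun t x => f (z.1 + (t : AddCircle T), x))
    (s := fun _ => Metric.closedBall 0 (max R₁ R₂)) (fun t _ => hL _) c₁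
    (fun t ht => (h₁.2 t ht.1).mono (Ici_subset_Ici.2 ht.1)) (fun t ht => ?_) c₂
    (fun t ht => (h₂.2 t ht.1).mono (Ici_subset_Ici.2 ht.1)) (fun t ht => ?_)
    (h₁.1.trans h₂.1.symm) ⟨hθ, le_rfl⟩
  · simpa using Or.inl (hR₁ t (Ico_subset_Icc_self ht))
  · simpa using Or.inr (hR₂ t (Ico_subset_Icc_self ht))

theorem isForwardSolution_flowX (hc : ForwardComplete f) (z : Cylinder T n) :
    IsForwardSolution f z (fun θ => flowX f θ z) := by
  have h := hc z
  have e : (fun θ => flowX f θ z) = h.choose := by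
    funext θ
    simp [flowX, h]
  rw [e]
  exact h.choose_spec

theorem flow_zero (hc : ForwardComplete f) (z : Cylinder T n) : flow f 0 z = z := by
  have := (isForwardSolution_flowX hc z).1
  simp only at this
  simp [flow, this]

theorem flow_add (hT : 0 < T) (hf : IsAdmissible f) (hc : ForwardComplete f) (z : Cylinder T n)
    {a b : ℝ} (ha : 0 ≤ a) (hb : 0 ≤ b) : flow f (a + b) z = flow f b (flow f a z) := by
  have h₁ := isForwardSolution_flowX hc z
  have h₂ : IsForwardSolution f (flow f a z) (fun θ => flowX f (a + θ) z) := by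
    refine ⟨by simp [flow], fun θ hθ => ?_⟩
    have h := h₁.2 (a + θ) (by positivity)
    have h' : HasDerivWithinAt (fun θ => a + θ) 1 (Ici 0) θ :=
      ((hasDerivAt_id θ).const_add a).hasDerivWithinAt
    have := HasDerivWithinAt.scomp (t' := Ici 0) θ h h' (fun x hx => add_nonneg ha hx)
    rw [one_smul, AddCircle.coe_add, ← add_assoc] at this
    exact this
  have := h₂.eq hT hf (isForwardSolution_flowX hc _) hb
  simp only [flow] at this ⊢
  simp [this, add_assoc]

theorem continuousOn_flow (hc : ForwardComplete f) (z : Cylinder T n) :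
    ContinuousOn (fun θ => flow f θ z) (Ici 0) := by
  refine ContinuousOn.prodMk ?_ (isForwardSolution_flowX hc z).continuousOn
  exact (continuous_const.add (AddCircle.continuous_mk' T)).continuousOn

theorem hasDerivWithinAt_flowX (hc : ForwardComplete f) (z : Cylinder T n) {θ : ℝ} (hθ : 0 ≤ θ) :
    HasDerivWithinAt (fun θ => flowX f θ z) (f (flow f θ z)) (Ici 0) θ :=
  (isForwardSolution_flowX hc z).2 θ hθ

end PeriodicContraction

/-! ### The metric along trajectories and exponential contraction near `G`. -/

namespace PeriodicContraction

variable {T : ℝ} {n : ℕ} {f : Cylinder T n → State n}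
  {M : Cylinder T n → Matrix (Fin n) (Fin n) ℝ} {G : Set (Cylinder T n)} {ν : ℝ}

theorem HasDerivWithinAt.dotProduct_mulVec {A : ℝ → Matrix (Fin n) (Fin n) ℝ}
    {A' : Matrix (Fin n) (Fin n) ℝ} {v : ℝ → Fin n → ℝ} {v' : Fin n → ℝ} {s : Set ℝ} {θ : ℝ}
    (hA : ∀ i j, HasDerivWithinAt (fun t => A t i j) (A' i j) s θ)
    (hv : HasDerivWithinAt v v' s θ) (hsymm : (A θ).IsSymm) :
    HasDerivWithinAt (fun t => v t ⬝ᵥ (A t *ᵥ v t))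
      (2 * (v θ ⬝ᵥ (A θ *ᵥ v')) + v θ ⬝ᵥ (A' *ᵥ v θ)) s θ := by
  have hvi := hasDerivWithinAt_pi.1 hv
  have h : HasDerivWithinAt (fun t => ∑ i, v t i * ∑ j, A t i j * v t j)
      (∑ i, (v' i * (∑ j, A θ i j * v θ j) +
        v θ i * ∑ j, (A' i j * v θ j + A θ i j * v' j))) s θ :=
    HasDerivWithinAt.fun_sum fun i _ => (hvi i).mul
      (HasDerivWithinAt.fun_sum fun j _ => (hA i j).mul (hvi j))
  refine h.congr_deriv ?_
  have e : v' ⬝ᵥ (A θ *ᵥ v θ) = v θ ⬝ᵥ (A θ *ᵥ v') := by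
    rw [Matrix.dotProduct_mulVec, ← Matrix.mulVec_transpose, hsymm, dotProduct_comm]
  rw [two_mul]
  nth_rewrite 1 [← e]
  simp only [Finset.sum_add_distrib, mul_add, Matrix.mulVec, dotProduct]
  ring

/-- Gronwall's inequality for the quadratic form. Right derivatives suffice, which is why a forward
orbital derivative of the metric is enough. -/
theorem dotProduct_mulVec_le_exp {A A' : ℝ → Matrix (Fin n) (Fin n) ℝ} {v v' : ℝ → Fin n → ℝ}
    {b c : ℝ} (hAc : ∀ i j, ContinuousOn (fun t => A t i j) (Icc 0 b))
    (hvc : ContinuousOn v (Icc 0 b))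
    (hA : ∀ θ ∈ Ico 0 b, ∀ i j, HasDerivWithinAt (fun t => A t i j) (A' θ i j) (Ici θ) θ)
    (hv : ∀ θ ∈ Ico 0 b, HasDerivWithinAt v (v' θ) (Ici θ) θ)
    (hsymm : ∀ θ ∈ Ico 0 b, (A θ).IsSymm)
    (hle : ∀ θ ∈ Ico 0 b, 2 * (v θ ⬝ᵥ (A θ *ᵥ v' θ)) + v θ ⬝ᵥ (A' θ *ᵥ v θ) ≤
      -c * (v θ ⬝ᵥ (A θ *ᵥ v θ))) :
    ∀ θ ∈ Icc 0 b, v θ ⬝ᵥ (A θ *ᵥ v θ) ≤ (v 0 ⬝ᵥ (A 0 *ᵥ v 0)) * Real.exp (-c * θ) := by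
  intro θ hθ
  have hvi := fun i => continuousOn_pi.1 hvc i
  have hc : ContinuousOn (fun t => v t ⬝ᵥ (A t *ᵥ v t)) (Icc 0 b) := by
    simp only [dotProduct, Matrix.mulVec]
    exact continuousOn_finsetSum _ fun i _ => (hvi i).mul
      (continuousOn_finsetSum _ fun j _ => (hAc i j).mul (hvi j))
  have := le_gronwallBound_of_liminf_deriv_right_le (δ := v 0 ⬝ᵥ (A 0 *ᵥ v 0)) (K := -c) (ε := 0)
    (f' := fun θ => 2 * (v θ ⬝ᵥ (A θ *ᵥ v' θ)) + v θ ⬝ᵥ (A' θ *ᵥ v θ)) hc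
    (fun x hx r hr => (HasDerivWithinAt.dotProduct_mulVec (hA x hx) (hv x hx)
      (hsymm x hx)).liminf_right_slope_le hr) le_rfl
    (fun x hx => by simpa using hle x hx) θ hθ
  simpa [gronwallBound_ε0] using this

theorem IsRiemannianMetric.isSymm (hM : IsRiemannianMetric f M) (z : Cylinder T n) :
    (M z).IsSymm := by
  simpa using (hM.posDef z).isHermitian

theorem IsRiemannianMetric.continuous_apply (hM : IsRiemannianMetric f M) (i j : Fin n) :
    Continuous fun z => M z i j :=
  hM.continuous.matrix_elem i j

/-- By the semigroup law, the orbital quotient at the point reached at time `θ` is the slope of `M`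
along the original trajectory. -/
theorem IsRiemannianMetric.hasDerivWithinAt_flow (hM : IsRiemannianMetric f M) (hT : 0 < T)
    (hf : IsAdmissible f) (hc : ForwardComplete f) (z : Cylinder T n) {θ : ℝ} (hθ : 0 ≤ θ)
    (i j : Fin n) :
    HasDerivWithinAt (fun s => M (flow f s z) i j)
      (forwardOrbitalDeriv f M (flow f θ z) i j) (Ici θ) θ := by
  have h := tendsto_nhds_limUnder (hM.orbitalDeriv_exists (flow f θ z))
  rw [← hasDerivWithinAt_Ioi_iff_Ici, hasDerivWithinAt_iff_tendsto_slope' (by simp)]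
  have h2 : Tendsto (fun s => s - θ) (𝓝[>] θ) (𝓝[>] 0) := by
    refine tendsto_nhdsWithin_iff.2 ⟨?_, ?_⟩
    · have : Tendsto (fun s => s - θ) (𝓝 θ) (𝓝 (θ - θ)) := (continuous_id.sub continuous_const).tendsto θ
      rw [sub_self] at this
      exact this.mono_left nhdsWithin_le_nhds
    · filter_upwards [self_mem_nhdsWithin] with s hs
      simpa using hs
  have h3 := ((tendsto_pi_nhds.1 ((tendsto_pi_nhds.1 h) i)) j).comp h2
  refine h3.congr' ?_
  filter_upwards [self_mem_nhdsWithin] with s hs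
  have hs' : 0 ≤ s - θ := sub_nonneg.2 (le_of_lt hs)
  simp only [Function.comp, orbitalQuotient, slope_def_field, ← flow_add hT hf hc z hθ hs',
    add_sub_cancel, Matrix.smul_apply, Matrix.sub_apply, smul_eq_mul]
  ring

theorem IsRiemannianMetric.dotProduct_pos (hM : IsRiemannianMetric f M) (z : Cylinder T n)
    {w : Fin n → ℝ} (hw : w ≠ 0) : 0 < w ⬝ᵥ (M z *ᵥ w) := by
  simpa using (hM.posDef z).dotProduct_mulVec_pos hw

/-- Both sides are quadratic in `w`, so the bound on the unit sphere of `M z` extends to all vectors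
after scaling by `(wᵀ M w)^(-1/2)`. -/
theorem two_mul_add_le_of_contractionFun_le (hM : IsRiemannianMetric f M) {z : Cylinder T n}
    (h : contractionFun f M z ≤ ((-ν : ℝ) : EReal)) (w : Fin n → ℝ) :
    2 * (w ⬝ᵥ (M z *ᵥ (jacobianX f z *ᵥ w))) + w ⬝ᵥ (forwardOrbitalDeriv f M z *ᵥ w) ≤
      -(2 * ν) * (w ⬝ᵥ (M z *ᵥ w)) := by
  have e : ∀ u : Fin n → ℝ, u ⬝ᵥ ((M z * jacobianX f z + (1 / 2 : ℝ) •
      forwardOrbitalDeriv f M z) *ᵥ u) = u ⬝ᵥ (M z *ᵥ (jacobianX f z *ᵥ u)) +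
      1 / 2 * (u ⬝ᵥ (forwardOrbitalDeriv f M z *ᵥ u)) := by
    intro u
    rw [Matrix.add_mulVec, dotProduct_add, Matrix.smul_mulVec, dotProduct_smul, smul_eq_mul,
      Matrix.mulVec_mulVec]
  rcases eq_or_ne w 0 with rfl | hw
  · simp
  have hc := hM.dotProduct_pos z hw
  set c := w ⬝ᵥ (M z *ᵥ w) with hcd
  set r := (Real.sqrt c)⁻¹ with hr
  have hr2 : r * r = c⁻¹ := by rw [hr, ← mul_inv, Real.mul_self_sqrt hc.le]
  have hu : (r • w) ⬝ᵥ (M z *ᵥ (r • w)) = 1 := by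
    rw [Matrix.mulVec_smul, dotProduct_smul, smul_dotProduct, smul_eq_mul, smul_eq_mul,
      ← mul_assoc, hr2, ← hcd, inv_mul_cancel₀ hc.ne']
  have h1 := (iSup₂_le_iff.1 h) (r • w) hu
  rw [EReal.coe_le_coe_iff, e] at h1
  simp only [Matrix.mulVec_smul, dotProduct_smul, smul_dotProduct, smul_eq_mul] at h1
  have h2 : c⁻¹ * (w ⬝ᵥ (M z *ᵥ (jacobianX f z *ᵥ w)) +
      1 / 2 * (w ⬝ᵥ (forwardOrbitalDeriv f M z *ᵥ w))) ≤ -ν := by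
    rw [← hr2]; linarith
  rw [inv_mul_le_iff₀ hc] at h2
  linarith

theorem IsRiemannianMetric.exists_lower_bound (hM : IsRiemannianMetric f M) (hG : IsCompact G) :
    ∃ c > 0, ∀ z ∈ G, ∀ v : State n, c * ‖v‖ ^ 2 ≤ v.ofLp ⬝ᵥ (M z *ᵥ v.ofLp) := by
  have hK : IsCompact (G ×ˢ Metric.sphere (0 : State n) 1) := hG.prod (isCompact_sphere 0 1)
  have hcont : Continuous fun p : Cylinder T n × State n =>
      p.2.ofLp ⬝ᵥ (M p.1 *ᵥ p.2.ofLp) := by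
    have : Continuous fun p : Cylinder T n × State n => p.2.ofLp :=
      (PiLp.continuous_ofLp 2 _).comp continuous_snd
    exact this.dotProduct ((hM.continuous.comp continuous_fst).matrix_mulVec this)
  obtain ⟨c, hc0, hc⟩ : ∃ c > 0, ∀ p ∈ G ×ˢ Metric.sphere (0 : State n) 1,
      c ≤ p.2.ofLp ⬝ᵥ (M p.1 *ᵥ p.2.ofLp) := by
    -- The product is empty if `G` is empty or `n = 0`; any positive constant then works.
    rcases (G ×ˢ Metric.sphere (0 : State n) 1).eq_empty_or_nonempty with he | hne
    · exact ⟨1, one_pos, by simp [he]⟩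
    · obtain ⟨p, hp, hmin⟩ := hK.exists_isMinOn hne hcont.continuousOn
      refine ⟨_, hM.dotProduct_pos p.1 (w := p.2.ofLp) fun h0 => ?_, fun q hq => hmin hq⟩
      have h1 : ‖p.2‖ = 1 := by simpa using hp.2
      have h2 : p.2 = 0 := by ext i; simp [h0]
      rw [h2, norm_zero] at h1
      exact zero_ne_one h1
  refine ⟨c, hc0, fun z hz v => ?_⟩
  rcases eq_or_ne v 0 with rfl | hv
  · simp
  have hv' : 0 < ‖v‖ := norm_pos_iff.2 hv
  have := hc (z, ‖v‖⁻¹ • v) ⟨hz, by simp [norm_smul, hv'.ne']⟩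
  simp only [WithLp.ofLp_smul, Matrix.mulVec_smul, dotProduct_smul, smul_dotProduct,
    smul_eq_mul] at this
  calc c * ‖v‖ ^ 2 ≤ ‖v‖⁻¹ * (‖v‖⁻¹ * (v.ofLp ⬝ᵥ (M z *ᵥ v.ofLp))) * ‖v‖ ^ 2 := by gcongr
    _ = _ := by field_simp

theorem IsRiemannianMetric.exists_upper_bound (hM : IsRiemannianMetric f M) (hG : IsCompact G) :
    ∃ C > 0, ∀ z ∈ G, ∀ v w : State n, v.ofLp ⬝ᵥ (M z *ᵥ w.ofLp) ≤ C * ‖v‖ * ‖w‖ := by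
  have h : ∀ i j, ∃ C, ∀ z ∈ G, ‖M z i j‖ ≤ C := fun i j =>
    hG.exists_bound_of_continuousOn (hM.continuous_apply i j).continuousOn
  choose C hC using h
  refine ⟨∑ i, ∑ j, |C i j| + 1, by positivity, fun z hz v w => ?_⟩
  calc v.ofLp ⬝ᵥ (M z *ᵥ w.ofLp) = ∑ i, ∑ j, v i * (M z i j * w j) := by
        simp only [dotProduct, Matrix.mulVec, Finset.mul_sum]
    _ ≤ ∑ i, ∑ j, ‖v‖ * (|C i j| * ‖w‖) := by
        refine Finset.sum_le_sum fun i _ => Finset.sum_le_sum fun j _ => ?_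
        refine (le_abs_self _).trans ?_
        rw [abs_mul, abs_mul]
        exact mul_le_mul (abs_apply_le_norm v i)
          (mul_le_mul ((hC i j z hz).trans (le_abs_self _)) (abs_apply_le_norm w j)
            (abs_nonneg _) (abs_nonneg _)) (by positivity) (norm_nonneg _)
    _ = (∑ i, ∑ j, |C i j|) * ‖v‖ * ‖w‖ := by
        simp only [Finset.sum_mul]
        exact Finset.sum_congr rfl fun i _ => Finset.sum_congr rfl fun j _ => by ring
    _ ≤ _ := by gcongr; linarith

/-- Solutions that start near `G` approach the nearby solutions in `G` exponentially fast. -/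
theorem exists_exp_contraction (hT : 0 < T) (hf : IsAdmissible f) (hc : ForwardComplete f)
    (hG : IsCompact G) (hGinv : PositivelyInvariant f G) (hM : IsRiemannianMetric f M)
    (hν : 0 < ν) (hL : ∀ z ∈ G, contractionFun f M z ≤ ((-ν : ℝ) : EReal)) :
    ∃ δ > (0 : ℝ), ∃ C > (0 : ℝ), ∃ μ > (0 : ℝ), ∀ (t : AddCircle T) (x₀ x : State n),
      (t, x₀) ∈ G → ‖x - x₀‖ ≤ δ → ∀ θ : ℝ, 0 ≤ θ →
        ‖flowX f θ (t, x) - flowX f θ (t, x₀)‖ ≤ C * Real.exp (-μ * θ) * ‖x - x₀‖ := by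
  obtain ⟨a, ha0, ha⟩ := hM.exists_lower_bound hG
  obtain ⟨b, hb0, hb⟩ := hM.exists_upper_bound hG
  -- With this accuracy the remainder contributes at most `ν * a * ‖v‖ ^ 2`, so at most `ν` times
  -- the form: half of the available rate `2 * ν`.
  obtain ⟨δ, hδ0, hδ⟩ := exists_norm_increment_sub_le hf hG
    (show 0 < ν * a / (2 * b) by positivity)
  set C := Real.sqrt (b / a) + 1 with hC
  have hC1 : 1 ≤ C := by have := Real.sqrt_nonneg (b / a); linarith
  -- The form decays at rate `ν`, the norm at rate `ν / 2`. Starting within `δ / (2 * C)` keeps the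
  -- decay bound below `δ / 2`.
  refine ⟨δ / (2 * C), by positivity, C, by positivity, ν / 2, by positivity, ?_⟩
  intro t x₀ x hx₀ hx
  set v : ℝ → State n := fun θ => flowX f θ (t, x) - flowX f θ (t, x₀) with hv
  have hv0 : v 0 = x - x₀ := by
    exact congrArg₂ (· - ·) (isForwardSolution_flowX hc (t, x)).1
      (isForwardSolution_flowX hc (t, x₀)).1
  have hvd : ∀ θ, 0 ≤ θ →
      HasDerivWithinAt v (f (flow f θ (t, x)) - f (flow f θ (t, x₀))) (Ici 0) θ :=
    fun θ hθ => (hasDerivWithinAt_flowX hc _ hθ).sub (hasDerivWithinAt_flowX hc _ hθ)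
  have hvc : ContinuousOn v (Ici 0) := fun θ hθ => (hvd θ hθ).continuousWithinAt
  have hofLp : ∀ {s : Set ℝ} {θ : ℝ} {v' : State n}, HasDerivWithinAt v v' s θ →
      HasDerivWithinAt (fun θ => (v θ).ofLp) v'.ofLp s θ := fun h =>
    ((PiLp.continuousLinearEquiv 2 ℝ (fun _ : Fin n => ℝ)).hasFDerivAt.comp_hasDerivWithinAt _ h)
  have hflowc := (continuousOn_flow hc (t, x₀))
  have decay : ∀ B, (∀ θ ∈ Ico 0 B, ‖v θ‖ ≤ δ) → ∀ θ ∈ Icc 0 B,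
      ‖v θ‖ ≤ C * Real.exp (-(ν / 2) * θ) * ‖x - x₀‖ := by
    intro B hB θ hθ
    have hexp := dotProduct_mulVec_le_exp (A := fun θ => M (flow f θ (t, x₀)))
      (A' := fun θ => forwardOrbitalDeriv f M (flow f θ (t, x₀))) (v := fun θ => (v θ).ofLp)
      (v' := fun θ => (f (flow f θ (t, x)) - f (flow f θ (t, x₀))).ofLp) (b := B) (c := ν)
      (fun i j => (hM.continuous_apply i j).comp_continuousOn (hflowc.mono Icc_subset_Ici_self))
      ((PiLp.continuous_ofLp 2 _).comp_continuousOn (hvc.mono Icc_subset_Ici_self))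
      (fun θ hθ i j => hM.hasDerivWithinAt_flow hT hf hc _ hθ.1 i j)
      (fun θ hθ => hofLp ((hvd θ hθ.1).mono (Ici_subset_Ici.2 hθ.1)))
      (fun θ _ => hM.isSymm _) (fun θ hθ => ?_) θ hθ
    · have hz : flow f θ (t, x₀) ∈ G := hGinv _ hx₀ θ hθ.1
      have hz0 : flow f 0 (t, x₀) ∈ G := hGinv _ hx₀ 0 le_rfl
      have h1 := ha _ hz (v θ)
      have h2 := hb _ hz0 (v 0) (v 0)
      have h3 : a * ‖v θ‖ ^ 2 ≤ b * ‖v 0‖ * ‖v 0‖ * Real.exp (-ν * θ) :=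
        h1.trans (hexp.trans (by gcongr))
      rw [← hv0]
      have h4 : ‖v θ‖ ^ 2 ≤ (Real.sqrt (b / a) * Real.exp (-(ν / 2) * θ) * ‖v 0‖) ^ 2 := by
        rw [mul_pow, mul_pow, Real.sq_sqrt (by positivity), ← Real.exp_nat_mul,
          show ((2 : ℕ) : ℝ) * (-(ν / 2) * θ) = -ν * θ by push_cast; ring]
        rw [← mul_le_mul_iff_right₀ ha0]
        refine h3.trans_eq ?_
        field_simp
      refine (abs_le_of_sq_le_sq' h4 (by positivity)).2.trans ?_
      gcongr
      linarith
    · have hz : flow f θ (t, x₀) ∈ G := hGinv _ hx₀ θ hθ.1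
      have h1 := hδ _ hz (v θ) (hB θ hθ)
      have e : ((flow f θ (t, x₀)).1, (flow f θ (t, x₀)).2 + v θ) = flow f θ (t, x) := by
        simp [flow, hv]
      rw [e] at h1
      set z := flow f θ (t, x₀)
      have h2 := hb z hz (v θ) (f (flow f θ (t, x)) - f z - dirDeriv f z (v θ))
      have h3 := two_mul_add_le_of_contractionFun_le hM (hL z hz) (v θ).ofLp
      have h4 := ha z hz (v θ)
      have e2 : (dirDeriv f z (v θ)).ofLp = jacobianX f z *ᵥ (v θ).ofLp :=
        funext fun i => dirDeriv_apply z (v θ) i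
      have e3 : (v θ).ofLp ⬝ᵥ (M z *ᵥ (f (flow f θ (t, x)) - f z).ofLp) =
          (v θ).ofLp ⬝ᵥ (M z *ᵥ (f (flow f θ (t, x)) - f z - dirDeriv f z (v θ)).ofLp) +
          (v θ).ofLp ⬝ᵥ (M z *ᵥ (jacobianX f z *ᵥ (v θ).ofLp)) := by
        rw [WithLp.ofLp_sub _ (f (flow f θ (t, x)) - f z), e2, Matrix.mulVec_sub, dotProduct_sub]
        ring
      rw [e3]
      have h5 : b * ‖v θ‖ * ‖f (flow f θ (t, x)) - f z - dirDeriv f z (v θ)‖ ≤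
          ν / 2 * (a * ‖v θ‖ ^ 2) := by
        calc _ ≤ b * ‖v θ‖ * (ν * a / (2 * b) * ‖v θ‖) := by gcongr
          _ = _ := by field_simp
      have h6 : ν / 2 * (a * ‖v θ‖ ^ 2) ≤ ν / 2 * ((v θ).ofLp ⬝ᵥ (M z *ᵥ (v θ).ofLp)) := by
        gcongr
      linarith
  -- Continuation argument: at the first time `B` with `‖v B‖ ≥ δ` the decay estimate still applies
  -- and gives `‖v B‖ ≤ δ / 2`.
  have small : ∀ θ, 0 ≤ θ → ‖v θ‖ ≤ δ := by
    by_contra! hcon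
    obtain ⟨θ₁, hθ₁, hgt⟩ := hcon
    have hcl : IsCompact (Icc 0 θ₁ ∩ (fun θ => ‖v θ‖) ⁻¹' Ici δ) :=
      isCompact_Icc.of_isClosed_subset
        (((hvc.mono Icc_subset_Ici_self).norm).preimage_isClosed_of_isClosed isClosed_Icc
          isClosed_Ici) inter_subset_left
    obtain ⟨B, hB⟩ := hcl.exists_isLeast ⟨θ₁, ⟨hθ₁, le_rfl⟩, hgt.le⟩
    have hB1 : ∀ θ ∈ Ico 0 B, ‖v θ‖ ≤ δ := by
      intro θ hθ
      by_contra! h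
      exact absurd (hB.2 ⟨⟨hθ.1, hθ.2.le.trans hB.1.1.2⟩, h.le⟩) (not_le.2 hθ.2)
    have h1 := decay B hB1 B ⟨hB.1.1.1, le_rfl⟩
    have h2 : δ ≤ ‖v B‖ := hB.1.2
    have h3 : Real.exp (-(ν / 2) * B) ≤ 1 := by
      rw [Real.exp_le_one_iff]
      have := hB.1.1.1
      nlinarith
    have h4 : C * Real.exp (-(ν / 2) * B) * ‖x - x₀‖ ≤ C * 1 * (δ / (2 * C)) := by gcongr
    have h5 : C * 1 * (δ / (2 * C)) = δ / 2 := by field_simp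
    linarith
  exact fun θ hθ => decay θ (fun s hs => small s hs.1) θ ⟨hθ, le_rfl⟩

end PeriodicContraction

/-! ### Existence of the periodic orbit, its basin, and uniqueness. -/

namespace PeriodicContraction

variable {T : ℝ} {n : ℕ} {f : Cylinder T n → State n}
  {G Ω : Set (Cylinder T n)} {δ C μ : ℝ}

/-- Solutions starting `δ`-close to a point of `G`, at the same time, approach the solution through
that point exponentially fast. -/
def ContractsNear (f : Cylinder T n → State n) (G : Set (Cylinder T n)) (δ C μ : ℝ) : Prop :=
  ∀ (t : AddCircle T) (x₀ x : State n), (t, x₀) ∈ G → ‖x - x₀‖ ≤ δ → ∀ θ : ℝ, 0 ≤ θ →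
    ‖flowX f θ (t, x) - flowX f θ (t, x₀)‖ ≤ C * Real.exp (-μ * θ) * ‖x - x₀‖

theorem ContractsNear.dist_flow_le (h : ContractsNear f G δ C μ) {z z' : Cylinder T n}
    (hz : z ∈ G) (h1 : z'.1 = z.1) (h2 : ‖z'.2 - z.2‖ ≤ δ) {θ : ℝ} (hθ : 0 ≤ θ) :
    dist (flow f θ z') (flow f θ z) ≤ C * Real.exp (-μ * θ) * ‖z'.2 - z.2‖ := by
  obtain ⟨t, x⟩ := z
  obtain ⟨t', x'⟩ := z'
  obtain rfl : t' = t := h1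
  rw [Prod.dist_eq]
  have h3 := h t' x x' hz h2 θ hθ
  refine max_le ?_ (by simpa [flow, dist_eq_norm] using h3)
  simpa [flow] using (norm_nonneg _).trans h3

theorem ContractsNear.tendsto_dist_flow (h : ContractsNear f G δ C μ) (hμ : 0 < μ)
    {z z' : Cylinder T n} (hz : z ∈ G) (h1 : z'.1 = z.1) (h2 : ‖z'.2 - z.2‖ ≤ δ) :
    Tendsto (fun θ => dist (flow f θ z') (flow f θ z)) atTop (𝓝 0) := by
  have h3 : Tendsto (fun θ : ℝ => C * Real.exp (-μ * θ) * ‖z'.2 - z.2‖) atTop (𝓝 0) := by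
    have : Tendsto (fun θ : ℝ => Real.exp (-μ * θ)) atTop (𝓝 0) :=
      Real.tendsto_exp_atBot.comp (tendsto_id.const_mul_atTop_of_neg (neg_lt_zero.2 hμ))
    simpa using (this.const_mul C).mul_const ‖z'.2 - z.2‖
  refine squeeze_zero' (Eventually.of_forall fun _ => dist_nonneg) ?_ h3
  filter_upwards [eventually_ge_atTop 0] with θ hθ
  exact h.dist_flow_le hz h1 h2 hθ

theorem flow_natCast_mul (hT : 0 < T) (hf : IsAdmissible f) (hc : ForwardComplete f)
    {z : Cylinder T n} {N : ℝ} (hN : 0 ≤ N) (hz : flow f N z = z) (m : ℕ) :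
    flow f (m * N) z = z := by
  induction m with
  | zero => simp [flow_zero hc]
  | succ m ih =>
    rw [Nat.cast_succ, add_mul, one_mul, flow_add hT hf hc _ (by positivity) hN, ih, hz]

/-- The time of return to the fibre is a multiple of the circumference. -/
theorem exists_nat_mul_of_flow_eq (hT : 0 < T) {z : Cylinder T n} {s : ℝ} (hs : 0 ≤ s)
    (h : flow f s z = z) : ∃ k : ℕ, s = k * T := by
  have h1 : (s : AddCircle T) = 0 := by
    have := congrArg Prod.fst h
    simpa [flow] using this
  obtain ⟨k, hk⟩ := (AddCircle.coe_eq_zero_iff T).1 h1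
  rw [zsmul_eq_mul] at hk
  have hk0 : 0 ≤ k := by
    by_contra! hneg
    have : (k : ℝ) < 0 := by exact_mod_cast hneg
    nlinarith
  refine ⟨k.toNat, ?_⟩
  rw [← hk]
  congr 1
  exact_mod_cast (Int.toNat_of_nonneg hk0).symm

theorem flow_natCast_mul_fst (k : ℕ) (z : Cylinder T n) : (flow f (k * T) z).1 = z.1 := by
  have : ((k * T : ℝ) : AddCircle T) = 0 :=
    (AddCircle.coe_eq_zero_iff T).2 ⟨k, by simp⟩
  simp [flow, this]

/-- A recurrence argument replaces Banach's theorem: `S_N` need not contract a whole fibre of `G`,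
but along the iterates of a nearly returning point the successive distances decay geometrically. -/
theorem exists_flow_eq_self (hT : 0 < T) (hf : IsAdmissible f) (hc : ForwardComplete f)
    (hG : IsCompact G) (hne : G.Nonempty) (hGinv : PositivelyInvariant f G)
    (h : ContractsNear f G δ C μ) (hδ : 0 < δ) (hμ : 0 < μ) (hC : 0 < C) :
    ∃ q ∈ G, ∃ N : ℝ, 0 < N ∧ flow f N q = q := by
  obtain ⟨z, hz⟩ := hne
  have hu : ∀ k : ℕ, flow f (k * T) z ∈ G := fun k => hGinv z hz _ (by positivity)
  obtain ⟨a, -, φ, hφ, hlim⟩ := hG.tendsto_subseq hu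
  obtain ⟨K, hK⟩ := Metric.cauchySeq_iff.1 hlim.cauchySeq δ hδ
  have hKK := hK (K + 1) (Nat.le_succ K) K le_rfl
  simp only [Function.comp] at hKK
  set y := flow f (φ K * T) z with hy
  have hyG : y ∈ G := hu _
  have hlt : φ K < φ (K + 1) := hφ (Nat.lt_succ_self K)
  set k := φ (K + 1) - φ K with hk
  have hk0 : 0 < k := Nat.sub_pos_of_lt hlt
  set N : ℝ := k * T with hN
  have hN0 : 0 < N := by positivity
  have hNy : flow f N y = flow f (φ (K + 1) * T) z := by
    rw [hy, ← flow_add hT hf hc _ (by positivity) hN0.le]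
    congr 1
    rw [hN, hk, Nat.cast_sub hlt.le]
    ring
  rw [← hNy] at hKK
  have hfstN : ∀ z : Cylinder T n, (flow f N z).1 = z.1 := flow_natCast_mul_fst k
  set w : ℕ → Cylinder T n := fun m => flow f (m * N) y with hw
  have hwG : ∀ m, w m ∈ G := fun m => hGinv y hyG _ (by positivity)
  have hw1 : ∀ m, (w m).1 = y.1 := fun m => by
    have := flow_natCast_mul_fst (f := f) (m * k) y
    rwa [Nat.cast_mul, mul_assoc] at this
  have hws : ∀ m, w (m + 1) = flow f N (w m) := fun m => by
    simp only [hw]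
    rw [Nat.cast_succ, add_mul, one_mul, flow_add hT hf hc _ (by positivity) hN0.le]
  -- The other order of composition: the consecutive points `w m`, `w (m + 1)` are images under the
  -- same flow map of `y` and `flow f N y`, which are `δ`-close in one fibre.
  have hws' : ∀ m, w (m + 1) = flow f (m * N) (flow f N y) := fun m => by
    simp only [hw]
    rw [Nat.cast_succ, add_mul, one_mul, add_comm, flow_add hT hf hc _ hN0.le (by positivity)]
  have hd : ‖(flow f N y).2 - y.2‖ ≤ δ := by
    rw [← dist_eq_norm]
    exact (le_max_right _ _).trans hKK.le
  have hcau : CauchySeq w := by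
    refine cauchySeq_of_le_geometric (Real.exp (-μ * N)) (C * δ) ?_ fun m => ?_
    · rw [Real.exp_lt_one_iff]
      nlinarith
    · rw [hws', dist_comm]
      refine (h.dist_flow_le hyG (hfstN y) hd (by positivity)).trans ?_
      rw [← Real.exp_nat_mul, show (m : ℝ) * (-μ * N) = -μ * (m * N) by ring, mul_right_comm]
      gcongr
  obtain ⟨q, hqG, hq⟩ := cauchySeq_tendsto_of_isComplete hG.isComplete hwG hcau
  refine ⟨q, hqG, N, hN0, ?_⟩
  have hq1 : q.1 = y.1 := by
    have h1 := (continuous_fst.tendsto q).comp hq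
    exact tendsto_nhds_unique h1 (tendsto_const_nhds.congr fun m => (hw1 m).symm)
  have hq2 : Tendsto (fun m => ‖(w m).2 - q.2‖) atTop (𝓝 0) :=
    tendsto_iff_norm_sub_tendsto_zero.1 ((continuous_snd.tendsto q).comp hq)
  -- Continuity of `S_N` at `q` within its fibre comes from the contraction estimate itself.
  have hfl : Tendsto (fun m => flow f N (w m)) atTop (𝓝 (flow f N q)) := by
    rw [tendsto_iff_dist_tendsto_zero]
    refine squeeze_zero' (Eventually.of_forall fun _ => dist_nonneg) ?_
      (by simpa only [mul_zero] using hq2.const_mul (C * Real.exp (-μ * N)))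
    filter_upwards [hq2.eventually_le_const hδ] with m hm
    exact h.dist_flow_le hqG ((hw1 m).trans hq1.symm) hm hN0.le
  refine tendsto_nhds_unique hfl ?_
  exact ((tendsto_add_atTop_iff_nat 1).2 hq).congr hws

/-- The forward orbit of `z`. -/
def orbit (f : Cylinder T n → State n) (z : Cylinder T n) : Set (Cylinder T n) :=
  (fun θ : ℝ => flow f θ z) '' Ici 0

theorem mem_orbit_self (hc : ForwardComplete f) (z : Cylinder T n) : z ∈ orbit f z :=
  ⟨0, self_mem_Ici, flow_zero hc z⟩

theorem orbit_subset (hGinv : PositivelyInvariant f G) {z : Cylinder T n} (hz : z ∈ G) :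
    orbit f z ⊆ G := by
  rintro _ ⟨θ, hθ, rfl⟩
  exact hGinv z hz θ hθ

/-- The flow has no backward times, so earlier points are reached by going forward to a multiple of
`N` beyond `a`. -/
theorem orbit_flow_eq (hT : 0 < T) (hf : IsAdmissible f) (hc : ForwardComplete f)
    {z : Cylinder T n} {N : ℝ} (hN : 0 < N) (hz : flow f N z = z) {a : ℝ} (ha : 0 ≤ a) :
    orbit f (flow f a z) = orbit f z := by
  apply Subset.antisymm
  · rintro _ ⟨θ, hθ, rfl⟩
    exact ⟨a + θ, add_nonneg ha hθ, flow_add hT hf hc z ha hθ⟩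
  · rintro _ ⟨θ, hθ, rfl⟩
    have hθ : 0 ≤ θ := hθ
    obtain ⟨m, hm⟩ := exists_nat_ge (a / N)
    have hm' : 0 ≤ m * N - a := by
      rw [div_le_iff₀ hN] at hm
      linarith
    refine ⟨(m * N - a) + θ, add_nonneg hm' hθ, ?_⟩
    simp only
    rw [← flow_add hT hf hc z ha (by positivity),
      show a + (m * N - a + θ) = m * N + θ by ring, flow_add hT hf hc z (by positivity) hθ,
      flow_natCast_mul hT hf hc hN.le hz]

theorem isCompact_orbit (hT : 0 < T) (hf : IsAdmissible f) (hc : ForwardComplete f)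
    {z : Cylinder T n} {N : ℝ} (hN : 0 < N) (hz : flow f N z = z) : IsCompact (orbit f z) := by
  have : orbit f z = (fun θ : ℝ => flow f θ z) '' Icc 0 N := by
    refine Subset.antisymm ?_ (image_mono Icc_subset_Ici_self)
    rintro _ ⟨θ, hθ, rfl⟩
    have hθ : 0 ≤ θ := hθ
    have h1 := Nat.floor_le (div_nonneg hθ hN.le)
    have h2 := Nat.lt_floor_add_one (θ / N)
    rw [le_div_iff₀ hN] at h1
    rw [div_lt_iff₀ hN] at h2
    refine ⟨θ - ⌊θ / N⌋₊ * N, ⟨by linarith, by linarith⟩, ?_⟩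
    simp only
    conv_rhs => rw [show θ = ⌊θ / N⌋₊ * N + (θ - ⌊θ / N⌋₊ * N) by ring,
      flow_add hT hf hc z (by positivity) (by linarith), flow_natCast_mul hT hf hc hN.le hz]
  rw [this]
  exact isCompact_Icc.image_of_continuousOn ((continuousOn_flow hc z).mono Icc_subset_Ici_self)

theorem flow_mem_basin_iff (hT : 0 < T) (hf : IsAdmissible f) (hc : ForwardComplete f)
    {z : Cylinder T n} {a : ℝ} (ha : 0 ≤ a) : flow f a z ∈ basin f Ω ↔ z ∈ basin f Ω := by
  have e : (fun θ => Metric.infDist (flow f θ (flow f a z)) Ω) =ᶠ[atTop]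
      fun θ => Metric.infDist (flow f (a + θ) z) Ω := by
    filter_upwards [eventually_ge_atTop 0] with θ hθ
    rw [flow_add hT hf hc z ha hθ]
  simp only [basin, mem_ofPred_eq]
  rw [tendsto_congr' e]
  constructor
  · intro h
    have := h.comp (tendsto_atTop_add_const_right atTop (-a) tendsto_id)
    refine this.congr fun θ => ?_
    simp
  · intro h
    exact h.comp (tendsto_atTop_add_const_left atTop a tendsto_id)

theorem mem_basin_of_tendsto_dist {z z' : Cylinder T n} (hz : z ∈ basin f Ω)
    (h : Tendsto (fun θ => dist (flow f θ z') (flow f θ z)) atTop (𝓝 0)) : z' ∈ basin f Ω := by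
  have h2 := hz.add h
  rw [add_zero] at h2
  exact squeeze_zero (fun _ => Metric.infDist_nonneg)
    (fun _ => Metric.infDist_le_infDist_add_dist) h2

theorem exists_coe_eq_abs_eq_norm (u : AddCircle T) : ∃ s : ℝ, (s : AddCircle T) = u ∧ |s| = ‖u‖ := by
  induction u using QuotientAddGroup.induction_on with
  | H x =>
    refine ⟨x - round (T⁻¹ * x) * T, ?_, (AddCircle.norm_eq T).symm⟩
    have : ((round (T⁻¹ * x) * T : ℝ) : AddCircle T) = 0 :=
      (AddCircle.coe_eq_zero_iff T).2 ⟨round (T⁻¹ * x), by simp⟩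
    rw [AddCircle.coe_sub, this, sub_zero]

theorem norm_flowX_sub_le (hc : ForwardComplete f) (hGinv : PositivelyInvariant f G) {F : ℝ}
    (hF : ∀ z ∈ G, ‖f z‖ ≤ F) {z : Cylinder T n} (hz : z ∈ G) {s : ℝ} (hs : 0 ≤ s) :
    ‖flowX f s z - z.2‖ ≤ F * s := by
  have := norm_image_sub_le_of_norm_deriv_right_le_segment (a := 0) (b := s)
    (f := fun θ => flowX f θ z) (f' := fun θ => f (flow f θ z)) (C := F)
    ((isForwardSolution_flowX hc z).continuousOn.mono Icc_subset_Ici_self)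
    (fun θ hθ => (hasDerivWithinAt_flowX hc z hθ.1).mono (Ici_subset_Ici.2 hθ.1))
    (fun θ hθ => hF _ (hGinv z hz θ hθ.1)) s ⟨hs, le_rfl⟩
  have h0 : flowX f 0 z = z.2 := (isForwardSolution_flowX hc z).1
  simpa [h0] using this

/-- Contraction compares only points of one fibre. Flowing one of the two points for the small time
difference puts them in the same fibre and moves it by at most `|F| * r`; the radius is chosen so
that `|F| * r + r = δ`. -/
theorem exists_dist_lt_mem_basin (hT : 0 < T) (hf : IsAdmissible f) (hc : ForwardComplete f)
    (hG : IsCompact G) (hGinv : PositivelyInvariant f G) (h : ContractsNear f G δ C μ)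
    (hδ : 0 < δ) (hμ : 0 < μ) (Ω : Set (Cylinder T n)) :
    ∃ r > 0, ∀ z ∈ G, ∀ z' ∈ G, dist z z' < r → z ∈ basin f Ω → z' ∈ basin f Ω := by
  obtain ⟨F, hF⟩ := hG.exists_bound_of_continuousOn hf.continuous.continuousOn
  set r := δ / (|F| + 1) with hr
  have hr0 : 0 < r := by positivity
  have hFr : |F| * r + r = δ := by
    rw [hr]; field_simp
  refine ⟨r, hr0, fun z hz z' hz' hd hzb => ?_⟩
  obtain ⟨s, hs, hsn⟩ := exists_coe_eq_abs_eq_norm (z'.1 - z.1)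
  rw [Prod.dist_eq, max_lt_iff] at hd
  have hsr : |s| ≤ r := by
    rw [hsn, ← dist_eq_norm, dist_comm]
    exact hd.1.le
  have hx : ‖z.2 - z'.2‖ ≤ r := by
    rw [← dist_eq_norm]
    exact hd.2.le
  have hmove : ∀ w ∈ G, ‖flowX f |s| w - w.2‖ ≤ |F| * r := fun w hw =>
    (norm_flowX_sub_le hc hGinv hF hw (abs_nonneg s)).trans
      ((mul_le_mul_of_nonneg_right (le_abs_self F) (abs_nonneg s)).trans (by gcongr))
  -- Only forward flow is available, so the point with the earlier time is the one that moves.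
  rcases le_total 0 s with h0 | h0
  · have hw := hmove z hz
    rw [abs_of_nonneg h0] at hw
    have hn : ‖z'.2 - (flow f s z).2‖ ≤ δ := by
      have : z'.2 - (flow f s z).2 = -((flowX f s z - z.2) + (z.2 - z'.2)) := by
        simp only [flow]; abel
      rw [this, norm_neg]
      exact (norm_add_le _ _).trans (by linarith)
    refine mem_basin_of_tendsto_dist ((flow_mem_basin_iff hT hf hc h0).2 hzb)
      (h.tendsto_dist_flow hμ (hGinv z hz s h0) ?_ hn)
    simp [flow, hs]
  · have hs0 : 0 ≤ -s := neg_nonneg.2 h0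
    have hw := hmove z' hz'
    rw [abs_of_nonpos h0] at hw
    have hn : ‖(flow f (-s) z').2 - z.2‖ ≤ δ := by
      have : (flow f (-s) z').2 - z.2 = (flowX f (-s) z' - z'.2) - (z.2 - z'.2) := by
        simp only [flow]; abel
      rw [this]
      exact (norm_sub_le _ _).trans (by linarith)
    rw [← flow_mem_basin_iff hT hf hc hs0]
    refine mem_basin_of_tendsto_dist hzb (h.tendsto_dist_flow hμ hz ?_ hn)
    simp [flow, hs]

theorem subset_basin (hT : 0 < T) (hf : IsAdmissible f) (hc : ForwardComplete f)
    (hG : IsCompact G) (hconn : IsConnected G) (hGinv : PositivelyInvariant f G)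
    (h : ContractsNear f G δ C μ) (hδ : 0 < δ) (hμ : 0 < μ) {q : Cylinder T n} (hq : q ∈ G) :
    G ⊆ basin f (orbit f q) := by
  obtain ⟨r, hr0, hr⟩ := exists_dist_lt_mem_basin hT hf hc hG hGinv h hδ hμ (orbit f q)
  have hqb : q ∈ basin f (orbit f q) := by
    refine tendsto_const_nhds.congr' ?_
    filter_upwards [eventually_ge_atTop 0] with θ hθ
    have : flow f θ q ∈ orbit f q := ⟨θ, hθ, rfl⟩
    exact (Metric.infDist_zero_of_mem this).symm
  intro z hz
  by_contra hzb
  -- Since `r` is uniform on `G`, the `r`-balls around points inside and outside the basin give an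
  -- open cover of `G`. A point of `G` common to both families links a basin point to a point
  -- outside it.
  set B := basin f (orbit f q)
  obtain ⟨p, hp, hpU, hpV⟩ := hconn.isPreconnected (⋃ a ∈ G ∩ B, Metric.ball a r)
    (⋃ a ∈ G \ B, Metric.ball a r)
    (isOpen_biUnion fun _ _ => Metric.isOpen_ball) (isOpen_biUnion fun _ _ => Metric.isOpen_ball)
    (fun x hx => by
      by_cases hxB : x ∈ B
      · exact Or.inl (mem_biUnion ⟨hx, hxB⟩ (Metric.mem_ball_self hr0))
      · exact Or.inr (mem_biUnion ⟨hx, hxB⟩ (Metric.mem_ball_self hr0)))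
    ⟨q, hq, mem_biUnion ⟨hq, hqb⟩ (Metric.mem_ball_self hr0)⟩
    ⟨z, hz, mem_biUnion ⟨hz, hzb⟩ (Metric.mem_ball_self hr0)⟩
  simp only [mem_iUnion, Metric.mem_ball] at hpU hpV
  obtain ⟨a, ha, hpa⟩ := hpU
  obtain ⟨b, hb, hpb⟩ := hpV
  rw [dist_comm] at hpa
  exact hb.2 (hr p hp b hb.1 hpb (hr a ha.1 p hp hpa ha.2))

theorem orbit_eq_of_mem_basin (hT : 0 < T) (hf : IsAdmissible f) (hc : ForwardComplete f)
    {q z : Cylinder T n} {N τ : ℝ} (hN : 0 < N) (hq : flow f N q = q) (hτ : 0 < τ)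
    (hz : flow f τ z = z) (hb : z ∈ basin f (orbit f q)) : orbit f z = orbit f q := by
  have hb' : Tendsto (fun θ => Metric.infDist (flow f θ z) (orbit f q)) atTop (𝓝 0) := hb
  have h1 : Tendsto (fun m : ℕ => Metric.infDist (flow f (m * τ) z) (orbit f q)) atTop (𝓝 0) :=
    hb'.comp (tendsto_natCast_atTop_atTop.atTop_mul_const hτ)
  simp only [flow_natCast_mul hT hf hc hτ.le hz] at h1
  have h2 := tendsto_nhds_unique h1 tendsto_const_nhds
  have h3 : z ∈ orbit f q :=
    ((isCompact_orbit hT hf hc hN hq).isClosed.mem_iff_infDist_zero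
      ⟨q, mem_orbit_self hc q⟩).2 h2.symm
  obtain ⟨a, ha, rfl⟩ := h3
  exact orbit_flow_eq hT hf hc hN hq ha

end PeriodicContraction

/-! ### Global existence for Lipschitz equations. -/

namespace PeriodicContraction

section GlobalExistence

variable {E : Type*} [NormedAddCommGroup E] [NormedSpace ℝ E]

/-- The weight `exp (2 * K * s)` turns a Lipschitz constant `K` into a factor `1 / 2`, uniformly in
the length of the interval. -/
theorem norm_integral_exp_weight_le {K d τ : ℝ} (hd : 0 ≤ d) (hτ : 0 ≤ τ)
    {g : ℝ → E} (hg : ∀ s, ‖g s‖ ≤ K * (Real.exp (2 * K * s) * d)) :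
    ‖∫ s in (0 : ℝ)..τ, g s‖ ≤ d / 2 * Real.exp (2 * K * τ) := by
  have hder : ∀ s : ℝ, HasDerivAt (fun s => d / 2 * Real.exp (2 * K * s))
      (K * (Real.exp (2 * K * s) * d)) s := by
    intro s
    have := (((hasDerivAt_id s).const_mul (2 * K)).exp).const_mul (d / 2)
    refine this.congr_deriv ?_
    simp only [id]
    ring
  have hint : IntervalIntegrable (fun s => K * (Real.exp (2 * K * s) * d)) volume 0 τ :=
    Continuous.intervalIntegrable (by fun_prop) _ _
  have h1 := intervalIntegral.norm_integral_le_of_norm_le hτ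
    (Eventually.of_forall fun s _ => hg s) hint
  rw [intervalIntegral.integral_eq_sub_of_hasDerivAt (fun s _ => hder s) hint] at h1
  have : 0 ≤ d / 2 * Real.exp (2 * K * 0) := by positivity
  linarith

/-- An ordinary differential equation with globally Lipschitz right hand side that vanishes at
the origin has a solution for all forward times. -/
theorem exists_forward_solution_of_lipschitz [CompleteSpace E] {v : ℝ → E → E}
    (hv : Continuous (Function.uncurry v)) {K : NNReal} (hK : 0 < K)
    (hL : ∀ t, LipschitzWith K (v t)) (h0 : ∀ t, v t 0 = 0) (x₀ : E) :
    ∃ y : ℝ → E, y 0 = x₀ ∧ ∀ t, 0 ≤ t → HasDerivAt y (v t (y t)) t := by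
  have hK' : (0 : ℝ) < K := hK
  have hgc : ∀ u : BoundedContinuousFunction ℝ E,
      Continuous fun s : ℝ => v s (Real.exp (2 * K * s) • u s) := fun u =>
    hv.comp (continuous_id.prodMk ((by fun_prop : Continuous fun s : ℝ =>
      Real.exp (2 * K * s)).smul u.continuous))
  have hdiff : ∀ (s : ℝ) (x y : E), ‖v s x - v s y‖ ≤ K * ‖x - y‖ := fun s x y => by
    simpa [dist_eq_norm] using (hL s).dist_le_mul x y
  have hgb : ∀ (u : BoundedContinuousFunction ℝ E) (s : ℝ),
      ‖v s (Real.exp (2 * K * s) • u s)‖ ≤ K * (Real.exp (2 * K * s) * ‖u‖) := fun u s => by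
    have := hdiff s (Real.exp (2 * K * s) • u s) 0
    rw [h0, sub_zero, sub_zero, norm_smul, Real.norm_eq_abs, abs_of_pos (Real.exp_pos _)] at this
    refine this.trans ?_
    gcongr
    exact u.norm_coe_le_norm s
  set y : BoundedContinuousFunction ℝ E → ℝ → E := fun u t =>
    x₀ + ∫ s in (0 : ℝ)..t, v s (Real.exp (2 * K * s) • u s) with hy
  have hyd : ∀ u t, HasDerivAt (y u) (v t (Real.exp (2 * K * t) • u t)) t := fun u t =>
    (intervalIntegral.integral_hasDerivAt_right ((hgc u).intervalIntegrable _ _)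
      ((hgc u).stronglyMeasurableAtFilter _ _) (hgc u).continuousAt).const_add x₀
  have hyc : ∀ u, Continuous (y u) := fun u =>
    continuous_iff_continuousAt.2 fun t => (hyd u t).continuousAt
  have hexp : ∀ t : ℝ, Real.exp (-(2 * K * t)) * Real.exp (2 * K * t) = 1 := fun t => by
    rw [← Real.exp_add, neg_add_cancel, Real.exp_zero]
  -- Picard's operator in the unknown `u t = exp (-2 K t) • y t`, which is bounded. Replacing `t` by
  -- `max t 0` makes the functions bounded on all of `ℝ` while changing nothing for `t ≥ 0`.
  let F : BoundedContinuousFunction ℝ E → BoundedContinuousFunction ℝ E := fun u =>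
    BoundedContinuousFunction.ofNormedAddCommGroup
      (fun t => Real.exp (-(2 * K * max t 0)) • y u (max t 0))
      (Continuous.smul (by fun_prop) ((hyc u).comp (by fun_prop)))
      (‖x₀‖ + ‖u‖ / 2) (fun t => by
        have ht : 0 ≤ max t 0 := le_max_right _ _
        have h1 := norm_integral_exp_weight_le (norm_nonneg u) ht (hgb u)
        have h2 : ‖y u (max t 0)‖ ≤ ‖x₀‖ + ‖u‖ / 2 * Real.exp (2 * K * max t 0) :=
          (norm_add_le _ _).trans (by gcongr)
        have h3 : Real.exp (-(2 * K * max t 0)) ≤ 1 := by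
          rw [Real.exp_le_one_iff]
          have : 0 ≤ 2 * K * max t 0 := by positivity
          linarith
        rw [norm_smul, Real.norm_eq_abs, abs_of_pos (Real.exp_pos _)]
        calc _ ≤ Real.exp (-(2 * K * max t 0)) *
              (‖x₀‖ + ‖u‖ / 2 * Real.exp (2 * K * max t 0)) := by gcongr
          _ = Real.exp (-(2 * K * max t 0)) * ‖x₀‖ + ‖u‖ / 2 *
              (Real.exp (-(2 * K * max t 0)) * Real.exp (2 * K * max t 0)) := by ring
          _ ≤ 1 * ‖x₀‖ + ‖u‖ / 2 * 1 := by rw [hexp]; gcongr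
          _ = _ := by ring)
  have hF : ContractingWith (1 / 2 : NNReal) F := by
    refine ⟨by rw [← NNReal.coe_lt_coe]; norm_num, LipschitzWith.of_dist_le_mul fun u w => ?_⟩
    rw [BoundedContinuousFunction.dist_le (by positivity)]
    intro t
    have ht : 0 ≤ max t 0 := le_max_right _ _
    have h1 : y u (max t 0) - y w (max t 0) = ∫ s in (0 : ℝ)..max t 0,
        (v s (Real.exp (2 * K * s) • u s) - v s (Real.exp (2 * K * s) • w s)) := by
      rw [intervalIntegral.integral_sub ((hgc u).intervalIntegrable _ _)
        ((hgc w).intervalIntegrable _ _)]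
      simp [hy]
    have h2 : ‖y u (max t 0) - y w (max t 0)‖ ≤ dist u w / 2 * Real.exp (2 * K * max t 0) := by
      rw [h1]
      refine norm_integral_exp_weight_le dist_nonneg ht fun s => (hdiff _ _ _).trans ?_
      rw [← smul_sub, norm_smul, Real.norm_eq_abs, abs_of_pos (Real.exp_pos _), ← dist_eq_norm]
      gcongr
      exact BoundedContinuousFunction.dist_coe_le_dist s
    change dist (Real.exp (-(2 * K * max t 0)) • y u (max t 0))
      (Real.exp (-(2 * K * max t 0)) • y w (max t 0)) ≤ _
    rw [dist_eq_norm, ← smul_sub, norm_smul, Real.norm_eq_abs, abs_of_pos (Real.exp_pos _)]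
    calc _ ≤ Real.exp (-(2 * K * max t 0)) * (dist u w / 2 * Real.exp (2 * K * max t 0)) := by
          gcongr
      _ = dist u w / 2 * (Real.exp (-(2 * K * max t 0)) * Real.exp (2 * K * max t 0)) := by ring
      _ = _ := by rw [hexp]; push_cast; ring
  set u := hF.fixedPoint F with hu
  have hfix : F u = u := hF.fixedPoint_isFixedPt
  refine ⟨y u, by simp [hy], fun t ht => ?_⟩
  have h1 : u t = Real.exp (-(2 * K * t)) • y u t := by
    conv_lhs => rw [← hfix]
    change Real.exp (-(2 * K * max t 0)) • y u (max t 0) = _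
    rw [max_eq_left ht]
  have h2 := hyd u t
  rwa [h1, smul_smul, mul_comm, hexp, one_smul] at h2

end GlobalExistence

end PeriodicContraction

/-! ### The first variation equation and Floquet exponents. -/

namespace PeriodicContraction

variable {T : ℝ} {n : ℕ} {f : Cylinder T n → State n}
  {M : Cylinder T n → Matrix (Fin n) (Fin n) ℝ} {G Ω : Set (Cylinder T n)} {ν : ℝ}
  {z : Cylinder T n}

theorem exists_abs_jacobianX_le (hf : IsAdmissible f) (hG : IsCompact G) :
    ∃ P, 0 < P ∧ ∀ z ∈ G, ∀ i j, |jacobianX f z i j| ≤ P := by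
  have h : ∀ j : Fin n, ∃ P, ∀ z ∈ G, ‖partialX f j z‖ ≤ P := fun j =>
    hG.exists_bound_of_continuousOn (hf.continuous_partial j).continuousOn
  choose P hP using h
  refine ⟨∑ j, |P j| + 1, by positivity, fun z hz i j => ?_⟩
  have h1 : |jacobianX f z i j| ≤ ‖partialX f j z‖ := abs_apply_le_norm (partialX f j z) i
  have h2 := Finset.single_le_sum (f := fun j => |P j|) (fun i _ => abs_nonneg _)
    (Finset.mem_univ j)
  have h3 := (hP j z hz).trans (le_abs_self _)
  linarith

theorem norm_map_ofReal_mulVec_le {A : Matrix (Fin n) (Fin n) ℝ} {P : ℝ} (hP : 0 ≤ P)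
    (hA : ∀ i j, |A i j| ≤ P) (v : Fin n → ℂ) :
    ‖A.map Complex.ofReal *ᵥ v‖ ≤ n * P * ‖v‖ := by
  rw [pi_norm_le_iff_of_nonneg (by positivity)]
  intro i
  have e : (A.map Complex.ofReal *ᵥ v) i = ∑ j, (A i j : ℂ) * v j := rfl
  rw [e]
  calc ‖∑ j, (A i j : ℂ) * v j‖ ≤ ∑ j, ‖(A i j : ℂ) * v j‖ := norm_sum_le _ _
    _ ≤ ∑ _j : Fin n, P * ‖v‖ := by
        refine Finset.sum_le_sum fun j _ => ?_
        rw [norm_mul, Complex.norm_real, Real.norm_eq_abs]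
        exact mul_le_mul (hA i j) (norm_le_pi_norm v j) (norm_nonneg _) hP
    _ = n * P * ‖v‖ := by simp; ring

theorem continuous_jacobianX (hf : IsAdmissible f) : Continuous (jacobianX f) :=
  continuous_matrix fun i j => (PiLp.continuous_apply 2 _ i).comp (hf.continuous_partial j)

/-- Along a trajectory in a compact set, the right hand side of the first variation equation is
Lipschitz uniformly in time. -/
theorem exists_lipschitz_variation (hf : IsAdmissible f) (hG : IsCompact G)
    (hGinv : PositivelyInvariant f G) (hz : z ∈ G) :
    ∃ K : NNReal, 0 < K ∧ ∀ θ, 0 ≤ θ → LipschitzWith K fun v : Fin n → ℂ =>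
      (jacobianX f (flow f θ z)).map Complex.ofReal *ᵥ v := by
  obtain ⟨P, hP0, hP⟩ := exists_abs_jacobianX_le hf hG
  refine ⟨(n * P + 1).toNNReal, by rw [Real.toNNReal_pos]; positivity, fun θ hθ => ?_⟩
  apply LipschitzWith.of_dist_le_mul
  intro v w
  rw [Real.coe_toNNReal _ (by positivity), dist_eq_norm, dist_eq_norm, ← Matrix.mulVec_sub]
  refine (norm_map_ofReal_mulVec_le hP0.le (hP _ (hGinv z hz θ hθ)) _).trans ?_
  gcongr
  linarith

theorem exists_isVariationSolution (hf : IsAdmissible f) (hc : ForwardComplete f)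
    (hG : IsCompact G) (hGinv : PositivelyInvariant f G) (hz : z ∈ G) (v : Fin n → ℂ) :
    ∃ y, y 0 = v ∧ IsVariationSolution f z y := by
  obtain ⟨K, hK0, hK⟩ := exists_lipschitz_variation hf hG hGinv hz
  have hcont : Continuous fun θ : ℝ => flow f (max θ 0) z :=
    (continuousOn_flow hc z).comp_continuous (by fun_prop) fun θ => mem_Ici.2 (le_max_right _ _)
  have hA : Continuous fun θ : ℝ => (jacobianX f (flow f (max θ 0) z)).map Complex.ofReal :=
    ((continuous_jacobianX hf).comp hcont).matrix_map Complex.continuous_ofReal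
  obtain ⟨y, hy0, hy⟩ := exists_forward_solution_of_lipschitz
    (v := fun θ w => (jacobianX f (flow f (max θ 0) z)).map Complex.ofReal *ᵥ w)
    ((hA.comp continuous_fst).matrix_mulVec continuous_snd) hK0
    (fun θ => hK _ (le_max_right _ _)) (fun θ => Matrix.mulVec_zero _) v
  refine ⟨y, hy0, fun θ hθ => ?_⟩
  have := (hy θ hθ).hasDerivWithinAt (s := Ici 0)
  rwa [max_eq_left hθ] at this

namespace IsVariationSolution

variable {y y₁ y₂ : ℝ → Fin n → ℂ}

theorem continuousOn (h : IsVariationSolution f z y) : ContinuousOn y (Ici 0) :=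
  fun θ hθ => (h θ hθ).continuousWithinAt

theorem add (h₁ : IsVariationSolution f z y₁) (h₂ : IsVariationSolution f z y₂) :
    IsVariationSolution f z (y₁ + y₂) := fun θ hθ =>
  ((h₁ θ hθ).add (h₂ θ hθ)).congr_deriv (Matrix.mulVec_add _ _ _).symm

theorem const_smul (c : ℂ) (h : IsVariationSolution f z y) :
    IsVariationSolution f z (c • y) := fun θ hθ =>
  ((h θ hθ).const_smul c).congr_deriv (Matrix.mulVec_smul _ _ _).symm

theorem shift (hT : 0 < T) (hf : IsAdmissible f) (hc : ForwardComplete f)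
    (h : IsVariationSolution f z y) {a : ℝ} (ha : 0 ≤ a) :
    IsVariationSolution f (flow f a z) fun θ => y (a + θ) := by
  intro θ hθ
  have h1 := h (a + θ) (add_nonneg ha hθ)
  have h2 : HasDerivWithinAt (fun θ => a + θ) 1 (Ici 0) θ :=
    ((hasDerivAt_id θ).const_add a).hasDerivWithinAt
  have h3 := HasDerivWithinAt.scomp (t' := Ici 0) θ h1 h2 (fun x hx => add_nonneg ha hx)
  rw [one_smul, flow_add hT hf hc z ha hθ] at h3
  exact h3

theorem eq_of_apply_zero_eq (hf : IsAdmissible f) (hG : IsCompact G)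
    (hGinv : PositivelyInvariant f G) (hz : z ∈ G) (h₁ : IsVariationSolution f z y₁)
    (h₂ : IsVariationSolution f z y₂) (h : y₁ 0 = y₂ 0) {θ : ℝ} (hθ : 0 ≤ θ) : y₁ θ = y₂ θ := by
  obtain ⟨K, -, hK⟩ := exists_lipschitz_variation hf hG hGinv hz
  exact ODE_solution_unique_of_mem_Icc_right (K := K)
    (v := fun θ w => (jacobianX f (flow f θ z)).map Complex.ofReal *ᵥ w) (s := fun _ => univ)
    (fun t ht => (hK t ht.1).lipschitzOnWith) (h₁.continuousOn.mono Icc_subset_Ici_self)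
    (fun t ht => (h₁ t ht.1).mono (Ici_subset_Ici.2 ht.1)) (fun _ _ => mem_univ _)
    (h₂.continuousOn.mono Icc_subset_Ici_self)
    (fun t ht => (h₂ t ht.1).mono (Ici_subset_Ici.2 ht.1)) (fun _ _ => mem_univ _) h ⟨hθ, le_rfl⟩

/-- Backward uniqueness, from the Lipschitz bound. It makes the period map injective, so that
multipliers are nonzero and have logarithms. -/
theorem eq_zero_of_apply_eq_zero (hf : IsAdmissible f) (hG : IsCompact G)
    (hGinv : PositivelyInvariant f G) (hz : z ∈ G) (h₁ : IsVariationSolution f z y) {b : ℝ}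
    (hb : 0 ≤ b) (h : y b = 0) : y 0 = 0 := by
  obtain ⟨K, -, hK⟩ := exists_lipschitz_variation hf hG hGinv hz
  have := ODE_solution_unique_of_mem_Icc_left (K := K) (a := 0) (b := b) (g := fun _ => 0)
    (v := fun θ w => (jacobianX f (flow f θ z)).map Complex.ofReal *ᵥ w) (s := fun _ => univ)
    (fun t ht => (hK t ht.1.le).lipschitzOnWith) (h₁.continuousOn.mono Icc_subset_Ici_self)
    (fun t ht => ((h₁ t ht.1.le).hasDerivAt (Ici_mem_nhds ht.1)).hasDerivWithinAt)
    (fun _ _ => mem_univ _) continuousOn_const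
    (fun t _ => by simpa using hasDerivWithinAt_const t (Iic t) (0 : Fin n → ℂ))
    (fun _ _ => mem_univ _) h
  exact this ⟨le_rfl, hb⟩

theorem comp_reCLM (h : IsVariationSolution f z y) {θ : ℝ} (hθ : 0 ≤ θ) :
    HasDerivWithinAt (fun θ i => (y θ i).re) (jacobianX f (flow f θ z) *ᵥ fun i => (y θ i).re)
      (Ici 0) θ := by
  refine hasDerivWithinAt_pi.2 fun i => ?_
  have h1 := Complex.reCLM.hasFDerivAt.comp_hasDerivWithinAt θ (hasDerivWithinAt_pi.1 (h θ hθ) i)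
  refine h1.congr_deriv ?_
  simp [Matrix.mulVec, dotProduct]

/-- The real part of a solution of the first variation equation decays in the metric `M`. -/
theorem dotProduct_re_le (hT : 0 < T) (hf : IsAdmissible f) (hc : ForwardComplete f)
    (hGinv : PositivelyInvariant f G) (hM : IsRiemannianMetric f M)
    (hL : ∀ z ∈ G, contractionFun f M z ≤ ((-ν : ℝ) : EReal)) (hz : z ∈ G)
    (h : IsVariationSolution f z y) {θ : ℝ} (hθ : 0 ≤ θ) :
    (fun i => (y θ i).re) ⬝ᵥ (M (flow f θ z) *ᵥ fun i => (y θ i).re) ≤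
      ((fun i => (y 0 i).re) ⬝ᵥ (M z *ᵥ fun i => (y 0 i).re)) * Real.exp (-(2 * ν) * θ) := by
  have := dotProduct_mulVec_le_exp (A := fun θ => M (flow f θ z))
    (A' := fun θ => forwardOrbitalDeriv f M (flow f θ z)) (v := fun θ i => (y θ i).re)
    (v' := fun θ => jacobianX f (flow f θ z) *ᵥ fun i => (y θ i).re) (b := θ) (c := 2 * ν)
    (fun i j => (hM.continuous_apply i j).comp_continuousOn
      ((continuousOn_flow hc z).mono Icc_subset_Ici_self))
    (fun t ht => ((h.comp_reCLM ht.1).continuousWithinAt).mono Icc_subset_Ici_self)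
    (fun t ht i j => hM.hasDerivWithinAt_flow hT hf hc _ ht.1 i j)
    (fun t ht => (h.comp_reCLM ht.1).mono (Ici_subset_Ici.2 ht.1))
    (fun t _ => hM.isSymm _)
    (fun t ht => two_mul_add_le_of_contractionFun_le hM (hL _ (hGinv z hz t ht.1)) _)
    θ ⟨hθ, le_rfl⟩
  simpa only [flow_zero hc] using this

end IsVariationSolution

/-- A multiplier of the first variation equation over a period `τ` has modulus at most
`exp (-ν τ)`. -/
theorem norm_le_exp_of_multiplier (hT : 0 < T) (hf : IsAdmissible f) (hc : ForwardComplete f)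
    (hGinv : PositivelyInvariant f G) (hM : IsRiemannianMetric f M)
    (hL : ∀ z ∈ G, contractionFun f M z ≤ ((-ν : ℝ) : EReal)) (hz : z ∈ G) {τ : ℝ} (hτ : 0 ≤ τ)
    (hper : flow f τ z = z) {y : ℝ → Fin n → ℂ} (h : IsVariationSolution f z y) (hy0 : y 0 ≠ 0)
    {κ : ℂ} (hκ : y τ = κ • y 0) : ‖κ‖ ≤ Real.exp (-ν * τ) := by
  have h1 := h.dotProduct_re_le hT hf hc hGinv hM hL hz hτ
  -- The real part of `-i y` is the imaginary part of `y`, so the real estimate covers both parts.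
  have h2 := (h.const_smul (-Complex.I)).dotProduct_re_le hT hf hc hGinv hM hL hz hτ
  rw [hper] at h1 h2
  set u : Fin n → ℝ := fun i => (y 0 i).re with hu
  set w : Fin n → ℝ := fun i => (y 0 i).im with hw
  have e1 : (fun i => (y τ i).re) = κ.re • u - κ.im • w := by
    ext i; simp [hκ, hu, hw]
  have e2 : (fun i => ((-Complex.I • y) τ i).re) = κ.re • w + κ.im • u := by
    ext i; simp [hκ, hu, hw]
  have e3 : (fun i => ((-Complex.I • y) 0 i).re) = w := by
    ext i; simp [hw]
  rw [e1] at h1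
  rw [e2, e3] at h2
  have hsum : 0 < u ⬝ᵥ (M z *ᵥ u) + w ⬝ᵥ (M z *ᵥ w) := by
    have hnn : ∀ x : Fin n → ℝ, 0 ≤ x ⬝ᵥ (M z *ᵥ x) := fun x => by
      rcases eq_or_ne x 0 with rfl | hx
      · simp
      · exact (hM.dotProduct_pos z hx).le
    rcases eq_or_ne u 0 with hu0 | hu0
    · refine add_pos_of_nonneg_of_pos (hnn u) (hM.dotProduct_pos z fun hw0 => hy0 ?_)
      ext i
      exact Complex.ext (congrFun hu0 i) (congrFun hw0 i)
    · exact add_pos_of_pos_of_nonneg (hM.dotProduct_pos z hu0) (hnn w)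
  -- Multiplication by `κ` mixes the two parts, but in the sum of the two forms the cross terms
  -- cancel.
  have e4 : (κ.re • u - κ.im • w) ⬝ᵥ (M z *ᵥ (κ.re • u - κ.im • w)) +
      (κ.re • w + κ.im • u) ⬝ᵥ (M z *ᵥ (κ.re • w + κ.im • u)) =
      ‖κ‖ ^ 2 * (u ⬝ᵥ (M z *ᵥ u) + w ⬝ᵥ (M z *ᵥ w)) := by
    rw [← Complex.normSq_eq_norm_sq, Complex.normSq_apply]
    simp only [Matrix.mulVec_add, Matrix.mulVec_sub, Matrix.mulVec_smul, dotProduct_add,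
      dotProduct_sub, add_dotProduct, sub_dotProduct, dotProduct_smul, smul_dotProduct,
      smul_eq_mul]
    ring
  have h3 : ‖κ‖ ^ 2 * (u ⬝ᵥ (M z *ᵥ u) + w ⬝ᵥ (M z *ᵥ w)) ≤
      Real.exp (-(2 * ν) * τ) * (u ⬝ᵥ (M z *ᵥ u) + w ⬝ᵥ (M z *ᵥ w)) := by
    rw [← e4]
    linarith
  have h4 := le_of_mul_le_mul_right h3 hsum
  refine (abs_le_of_sq_le_sq' (h4.trans_eq ?_) (Real.exp_pos _).le).2
  rw [← Real.exp_nat_mul]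
  congr 1
  push_cast
  ring

/-- The set of return times is the same for all points of a periodic orbit. -/
theorem flow_flow_eq_iff (hT : 0 < T) (hf : IsAdmissible f) (hc : ForwardComplete f) {N : ℝ}
    (hN : 0 < N) (hz : flow f N z = z) {a s : ℝ} (ha : 0 ≤ a) (hs : 0 ≤ s) :
    flow f s (flow f a z) = flow f a z ↔ flow f s z = z := by
  constructor
  · intro h
    obtain ⟨b, hb, hbz⟩ : z ∈ orbit f (flow f a z) := by
      rw [orbit_flow_eq hT hf hc hN hz ha]
      exact mem_orbit_self hc z
    have hb : 0 ≤ b := hb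
    simp only at hbz
    nth_rewrite 1 [← hbz]
    rw [← flow_add hT hf hc _ hb hs, add_comm, flow_add hT hf hc _ hs hb, h, hbz]
  · intro h
    rw [← flow_add hT hf hc _ ha hs, add_comm, flow_add hT hf hc _ hs ha, h]

/-- Return times are multiples of `T`, so well-ordering of `ℕ` provides the least one. -/
theorem exists_isLeast_period (hT : 0 < T) {N : ℝ} (hN : 0 < N) (hz : flow f N z = z) :
    ∃ τ, IsLeast {s : ℝ | 0 < s ∧ flow f s z = z} τ := by
  classical
  have hne : ∃ k : ℕ, 0 < (k * T : ℝ) ∧ flow f (k * T) z = z := by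
    obtain ⟨k, rfl⟩ := exists_nat_mul_of_flow_eq hT hN.le hz
    exact ⟨k, hN, hz⟩
  refine ⟨Nat.find hne * T, Nat.find_spec hne, ?_⟩
  rintro s ⟨hs, hsz⟩
  obtain ⟨k, rfl⟩ := exists_nat_mul_of_flow_eq hT hs.le hsz
  gcongr
  exact Nat.find_min' hne ⟨hs, hsz⟩

theorem isGreatest_floquet (hT : 0 < T) (hn : 0 < n) (hf : IsAdmissible f)
    (hc : ForwardComplete f) (hG : IsCompact G) (hGinv : PositivelyInvariant f G)
    (hM : IsRiemannianMetric f M) (hL : ∀ z ∈ G, contractionFun f M z ≤ ((-ν : ℝ) : EReal))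
    {q : Cylinder T n} (hq : q ∈ G) {N : ℝ} (hN : 0 < N) (hqN : flow f N q = q) :
    ∃ r : ℝ, IsGreatest {r : ℝ | ∃ l : ℂ, IsFloquetExponent f (orbit f q) l ∧ l.re = r} r ∧
      r ≤ -ν := by
  obtain ⟨τ, hτ⟩ := exists_isLeast_period hT hN hqN
  have hτ0 : 0 < τ := hτ.1.1
  have hqτ : flow f τ q = q := hτ.1.2
  choose Y hY0 hY using fun v => exists_isVariationSolution hf hc hG hGinv hq v
  have huniq : ∀ {y : ℝ → Fin n → ℂ}, IsVariationSolution f q y → ∀ {θ : ℝ}, 0 ≤ θ →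
      Y (y 0) θ = y θ := fun hy _ hθ =>
    (hY _).eq_of_apply_zero_eq hf hG hGinv hq hy (hY0 _) hθ
  -- The period map (monodromy); it is linear because solutions are determined by their initial
  -- values.
  let Φ : Module.End ℂ (Fin n → ℂ) :=
    { toFun := fun v => Y v τ
      map_add' := fun v w => by
        have := huniq ((hY v).add (hY w)) hτ0.le
        simpa [hY0] using this
      map_smul' := fun c v => by
        have := huniq ((hY v).const_smul c) hτ0.le
        simpa [hY0] using this }
  have hΦ : ∀ v, Φ v = Y v τ := fun _ => rfl
  set R := {r : ℝ | ∃ l : ℂ, IsFloquetExponent f (orbit f q) l ∧ l.re = r} with hR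
  -- An exponent `l` yields the multiplier `exp (l τ)`. The definition allows any base point of the
  -- orbit, so the solution is followed until the trajectory reaches `q`; its value there is the
  -- eigenvector.
  have hmult : ∀ r ∈ R, ∃ κ : ℂ, Φ.HasEigenvalue κ ∧ ‖κ‖ = Real.exp (r * τ) := by
    rintro _ ⟨l, ⟨z, ⟨a, ha, rfl⟩, τ', hτ', p, hp0, hp, hvar⟩, rfl⟩
    have ha : 0 ≤ a := ha
    have hset : {s : ℝ | 0 < s ∧ flow f s (flow f a q) = flow f a q} =
        {s : ℝ | 0 < s ∧ flow f s q = q} := by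
      ext s
      exact and_congr_right fun hs => flow_flow_eq_iff hT hf hc hN hqN ha hs.le
    simp only [hset] at hτ'
    obtain rfl : τ' = τ := hτ'.unique hτ
    obtain ⟨b, hb, hbq⟩ : q ∈ orbit f (flow f a q) := by
      rw [orbit_flow_eq hT hf hc hN hqN ha]
      exact mem_orbit_self hc q
    have hb : 0 ≤ b := hb
    simp only at hbq
    have hsh := hvar.shift hT hf hc hb
    rw [hbq] at hsh
    have hne : Complex.exp (l * b) • p b ≠ 0 := fun h0 => hp0 <| by
      simpa using hvar.eq_zero_of_apply_eq_zero hf hG hGinv (hGinv q hq a ha) hb h0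
    refine ⟨Complex.exp (l * τ'), ?_, by rw [Complex.norm_exp]; simp⟩
    refine Module.End.hasEigenvalue_of_hasEigenvector (x := Complex.exp (l * b) • p b)
      (Module.End.hasEigenvector_iff.2 ⟨Module.End.mem_eigenspace_iff.2 ?_, hne⟩)
    have h1 := huniq hsh hτ0.le
    simp only [add_zero] at h1
    rw [hΦ, h1, hp b hb, smul_smul, ← Complex.exp_add]
    congr 2
    push_cast
    ring
  have hfin : R.Finite := by
    refine (Φ.finite_hasEigenvalue.image fun κ => Real.log ‖κ‖ / τ).subset fun r hr => ?_
    obtain ⟨κ, hκ, hr⟩ := hmult r hr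
    refine ⟨κ, hκ, ?_⟩
    simp only
    rw [hr, Real.log_exp, mul_div_assoc, div_self hτ0.ne', mul_one]
  have hne : R.Nonempty := by
    have : Nonempty (Fin n) := ⟨⟨0, hn⟩⟩
    obtain ⟨κ, hκ⟩ := Module.End.exists_eigenvalue Φ
    obtain ⟨v, hv⟩ := hκ.exists_hasEigenvector
    have hYv : Y v τ = κ • v := hv.apply_eq_smul
    have hκ0 : κ ≠ 0 := by
      rintro rfl
      rw [zero_smul] at hYv
      exact hv.2 ((hY0 v).symm.trans
        ((hY v).eq_zero_of_apply_eq_zero hf hG hGinv hq hτ0.le hYv))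
    -- Conversely a multiplier `κ` gives the exponent `log κ / τ`; any branch would do, as the real
    -- part depends only on `‖κ‖`.
    have hexp : Complex.exp (Complex.log κ / τ * τ) = κ := by
      rw [div_mul_cancel₀ _ (by exact_mod_cast hτ0.ne'), Complex.exp_log hκ0]
    set l := Complex.log κ / τ
    have hprod : ∀ θ : ℝ, Complex.exp (l * θ) • Complex.exp (-(l * θ)) • Y v θ = Y v θ := by
      intro θ
      rw [smul_smul, ← Complex.exp_add, add_neg_cancel, Complex.exp_zero, one_smul]
    refine ⟨l.re, l, ⟨q, mem_orbit_self hc q, τ, hτ, fun θ => Complex.exp (-(l * θ)) • Y v θ,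
      ?_, fun θ hθ => ?_, ?_⟩, rfl⟩
    · simpa [hY0] using hv.2
    · have h1 := (hY v).shift hT hf hc hτ0.le
      rw [hqτ] at h1
      have h2 := h1.eq_of_apply_zero_eq hf hG hGinv hq ((hY v).const_smul κ)
        (by simp [hY0, hYv]) hθ
      beta_reduce
      rw [add_comm θ τ, h2, Pi.smul_apply, smul_smul]
      congr 1
      nth_rewrite 1 [← hexp]
      rw [← Complex.exp_add]
      congr 1
      push_cast
      ring
    · simpa only [hprod] using hY v
  obtain ⟨r, hr⟩ : ∃ r, IsGreatest R r :=
    ⟨_, hne.csSup_mem hfin, fun x hx => le_csSup hfin.bddAbove hx⟩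
  refine ⟨r, hr, ?_⟩
  obtain ⟨κ, hκ, hκr⟩ := hmult r hr.1
  obtain ⟨v, hv⟩ := hκ.exists_hasEigenvector
  have h1 := norm_le_exp_of_multiplier hT hf hc hGinv hM hL hq hτ0.le hqτ (hY v)
    (by rw [hY0]; exact hv.2) (by rw [hY0]; exact hv.apply_eq_smul)
  rw [hκr, Real.exp_le_exp] at h1
  exact le_of_mul_le_mul_right h1 hτ0

end PeriodicContraction

theorem theorem3p3 {T : ℝ} (hT : 0 < T) {n : ℕ} (hn : 0 < n)
    (f : PeriodicContraction.Cylinder T n → PeriodicContraction.State n)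
    (hf : PeriodicContraction.IsAdmissible f)
    (hcomplete : PeriodicContraction.ForwardComplete f)
    (G : Set (PeriodicContraction.Cylinder T n))
    (hGcompact : IsCompact G) (hGconn : IsConnected G)
    (hGinv : PeriodicContraction.PositivelyInvariant f G)
    (M : PeriodicContraction.Cylinder T n → Matrix (Fin n) (Fin n) ℝ)
    (hM : PeriodicContraction.IsRiemannianMetric f M)
    (ν : ℝ) (hν : 0 < ν)
    (hL : ∀ z ∈ G, PeriodicContraction.contractionFun f M z ≤ ((-ν : ℝ) : EReal)) :
    ∃ Ω : Set (PeriodicContraction.Cylinder T n),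
      (PeriodicContraction.IsPeriodicOrbit f Ω ∧ Ω ⊆ G) ∧
      (∀ Ω' : Set (PeriodicContraction.Cylinder T n),
        PeriodicContraction.IsPeriodicOrbit f Ω' → Ω' ⊆ G → Ω' = Ω) ∧
      PeriodicContraction.IsExponentiallyStable f Ω ∧
      G ⊆ PeriodicContraction.basin f Ω ∧
      (PeriodicContraction.OrbitalDerivIntegrable f M G →
        ∃ ν₀ : ℝ,
          IsGreatest {r : ℝ | ∃ l : ℂ, PeriodicContraction.IsFloquetExponent f Ω l ∧ l.re = r}
            (-ν₀) ∧
          -ν₀ ≤ -ν) := by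
  obtain ⟨δ, hδ, C, hC, μ, hμ, hcon⟩ :=
    PeriodicContraction.exists_exp_contraction hT hf hcomplete hGcompact hGinv hM hν hL
  obtain ⟨q, hq, N, hN, hqN⟩ := PeriodicContraction.exists_flow_eq_self hT hf hcomplete hGcompact
    hGconn.nonempty hGinv hcon hδ hμ hC
  have hbasin := PeriodicContraction.subset_basin hT hf hcomplete hGcompact hGconn hGinv hcon
    hδ hμ hq
  have hsub := PeriodicContraction.orbit_subset hGinv hq
  refine ⟨PeriodicContraction.orbit f q, ⟨⟨q, N, hN, hqN, rfl⟩, hsub⟩, ?_, ?_, hbasin,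
    fun _ => ?_⟩
  · rintro _ ⟨z, τ, hτ, hz, rfl⟩ hzG
    exact PeriodicContraction.orbit_eq_of_mem_basin hT hf hcomplete hN hqN hτ hz
      (hbasin (hzG (PeriodicContraction.mem_orbit_self hcomplete z)))
  · exact ⟨δ, hδ, C, hC, μ, hμ, fun t x₀ x hx₀ => hcon t x₀ x (hsub hx₀)⟩
  · obtain ⟨r, hr, hrν⟩ := PeriodicContraction.isGreatest_floquet hT hn hf hcomplete hGcompact
      hGinv hM hL hq hN hqN
    exact ⟨-r, by rwa [neg_neg], by rwa [neg_neg]⟩
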